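/- Let $\Lambda\subset\mathbb{R}^n$ be a lattice of full rank, let $T^n=\mathbb{R}^n/\Lambda$ be the flat torus with the metric induced by the standard metric of $\mathbb{R}^n$, let $1\le p\le n$ and let $\alpha,\beta,\alpha',\beta'>0$ be real numbers. On smooth (complex-valued) differential $p$-forms on $T^n$ consider the operator $F_{\alpha\beta,p}=\alpha\, d\delta+\beta\,\delta d$, where $d$ is the exterior derivative and $\delta$ its formal $L^2$-adjoint. Call $F_{\alpha\beta,p}$ and $F_{\alpha'\beta',p}$ isospectral if $\dim\ker(F_{\alpha\beta,p}-\lambda)=\dim\ker(F_{\alpha'\beta',p}-\lambda)$ for every $\lambda\in\mathbb{C}$, i.e. if they have the same eigenvalues with the same multiplicities. Then: 1. If $p<n$ and $n\ne 2p$, then $F_{\alpha\beta,p}$ and $F_{\alpha'\beta',p}$ are isospectral if and only if $(\alpha,\beta)=(\alpha',\beta')$. 2. If $n=2p$, then $F_{\alpha\beta,p}$ and $F_{\alpha'\beta',p}$ are isospectral if and only if $\{\alpha,\beta\}=\{\alpha',\beta'\}$. 3. If $p=n$ (where $\delta d=0$, so that $F_{\alpha\beta,n}=\alpha\, d\delta$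 does not depend on $\beta$), then $F_{\alpha\beta,n}$ and $F_{\alpha'\beta',n}$ are isospectral if and only if $\alpha=\alpha'$. -/

import Mathlib

noncomputable section

namespace FlatTorus

/-- Euclidean space `ℝⁿ` with its standard metric. -/
abbrev Euc (n : ℕ) : Type := EuclideanSpace ℝ (Fin n)

/-- `Λᵖ(ℝⁿ)* ⊗ ℂ`: alternating `ℝ`-multilinear `p`-forms on `ℝⁿ` with values in `ℂ`. -/
abbrev AltForm (n p : ℕ) : Type := Euc n [⋀^Fin p]→L[ℝ] ℂ

variable {n : ℕ} (Λ : Submodule ℤ (Euc n))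

/-- The torus `ℝⁿ / Λ`. -/
abbrev Torus : Type := Euc n ⧸ Λ.toAddSubgroup

/-- The canonical projection `ℝⁿ → ℝⁿ / Λ`. -/
abbrev proj (x : Euc n) : Torus Λ := QuotientAddGroup.mk x

/-- The space `Ωᵖ(ℝⁿ/Λ, ℂ)` of smooth complex-valued `p`-forms. All tangent spaces of `ℝⁿ/Λ` are
identified with `ℝⁿ` through the differential of the projection (a local isometry), so that a form
is a map from the torus to `Λᵖ(ℝⁿ)* ⊗ ℂ`; it is smooth if and only if its pullback to `ℝⁿ` is. -/
def SmoothForm (p : ℕ) : Submodule ℂ (Torus Λ → AltForm n p) where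
  carrier := {ω | ContDiff ℝ (⊤ : ℕ∞) fun x => ω (proj Λ x)}
  add_mem' {a b} ha hb := by
    change ContDiff ℝ (⊤ : ℕ∞) fun x => a (proj Λ x) + b (proj Λ x)
    exact ContDiff.add ha hb
  zero_mem' := by
    change ContDiff ℝ (⊤ : ℕ∞) fun _ : Euc n => (0 : AltForm n p)
    exact contDiff_const
  smul_mem' c a h := by
    change ContDiff ℝ (⊤ : ℕ∞) fun x => c • a (proj Λ x)
    exact ContDiff.const_smul c h

variable {Λ}

/-- The pullback to `ℝⁿ` of a form on `ℝⁿ / Λ`. -/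
def pull {p : ℕ} (ω : SmoothForm Λ p) (x : Euc n) : AltForm n p := ω.1 (proj Λ x)

theorem contDiff_pull {p : ℕ} (ω : SmoothForm Λ p) : ContDiff ℝ (⊤ : ℕ∞) (pull ω) := ω.2

theorem proj_add (x : Euc n) {v : Euc n} (hv : v ∈ Λ) : proj Λ (x + v) = proj Λ x := by
  rw [QuotientAddGroup.eq]
  simpa using Λ.neg_mem hv

theorem pull_add_lattice {p : ℕ} (ω : SmoothForm Λ p) (x : Euc n) {v : Euc n} (hv : v ∈ Λ) :
    pull ω (x + v) = pull ω x := by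
  simp only [pull, proj_add x hv]

theorem fderiv_pull_add_lattice {p : ℕ} (ω : SmoothForm Λ p) (x : Euc n) {v : Euc n}
    (hv : v ∈ Λ) : fderiv ℝ (pull ω) (x + v) = fderiv ℝ (pull ω) x := by
  rw [← fderiv_comp_add_right]
  congr 1
  funext y
  exact pull_add_lattice ω y hv

theorem pull_injective {p : ℕ} : Function.Injective (pull : SmoothForm Λ p → _) := by
  intro ω η h
  apply Subtype.ext
  funext t
  obtain ⟨x, rfl⟩ := QuotientAddGroup.mk_surjective t
  exact congrFun h x

/-- The smooth form on `ℝⁿ / Λ` whose pullback is a given smooth `Λ`-periodic form on `ℝⁿ`. -/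
def descend {p : ℕ} (f : Euc n → AltForm n p) (hf : ContDiff ℝ (⊤ : ℕ∞) f)
    (hper : ∀ x, ∀ v ∈ Λ, f (x + v) = f x) : SmoothForm Λ p :=
  ⟨Quotient.lift f (by
    intro a b h
    have h' : -a + b ∈ Λ := QuotientAddGroup.leftRel_apply.mp h
    simpa using (hper a _ h').symm), hf⟩

theorem pull_descend {p : ℕ} (f : Euc n → AltForm n p) (hf : ContDiff ℝ (⊤ : ℕ∞) f)
    (hper : ∀ x, ∀ v ∈ Λ, f (x + v) = f x) : pull (descend f hf hper) = f := rfl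

theorem fderiv_pull_add {p : ℕ} (ω η : SmoothForm Λ p) (x : Euc n) :
    fderiv ℝ (pull (ω + η)) x = fderiv ℝ (pull ω) x + fderiv ℝ (pull η) x :=
  fderiv_add ((contDiff_pull ω).differentiable (by simp) x)
    ((contDiff_pull η).differentiable (by simp) x)

theorem fderiv_pull_smul {p : ℕ} (c : ℂ) (ω : SmoothForm Λ p) (x : Euc n) :
    fderiv ℝ (pull (c • ω)) x = c • fderiv ℝ (pull ω) x :=
  fderiv_const_smul ((contDiff_pull ω).differentiable (by simp) x) c

/-- The exterior derivative `d : Ωᵖ → Ωᵖ⁺¹`, computed on pullbacks to `ℝⁿ`. -/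
def d (p : ℕ) : SmoothForm Λ p →ₗ[ℂ] SmoothForm Λ (p + 1) where
  toFun ω := descend (extDeriv (pull ω))
    ((ContinuousAlternatingMap.alternatizeUncurryFinCLM ℝ (Euc n) ℂ).contDiff.comp
      ((contDiff_pull ω).fderiv_right (by simp)))
    (fun x v hv => by simp only [extDeriv, fderiv_pull_add_lattice ω x hv])
  map_add' ω η := by
    apply pull_injective
    funext x
    change extDeriv (pull (ω + η)) x = extDeriv (pull ω) x + extDeriv (pull η) x
    simp only [extDeriv, fderiv_pull_add, ContinuousAlternatingMap.alternatizeUncurryFin_add]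
  map_smul' c ω := by
    apply pull_injective
    funext x
    change extDeriv (pull (c • ω)) x = c • extDeriv (pull ω) x
    simp only [extDeriv, fderiv_pull_smul]
    exact ContinuousAlternatingMap.alternatizeUncurryFin_smul _ _

theorem pull_d {p : ℕ} (ω : SmoothForm Λ p) : pull (d p ω) = extDeriv (pull ω) := rfl

/-- The `i`-th standard basis vector `∂ᵢ`. -/
abbrev stdVec (i : Fin n) : Euc n := EuclideanSpace.single i (1 : ℝ)

/-- Interior multiplication `v ↦ v ⌟ a`, linear and continuous in both arguments. -/
def interior (p : ℕ) : AltForm n (p + 1) →L[ℝ] Euc n →L[ℝ] AltForm n p :=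
  (ContinuousAlternatingMap.curryLeftLI (𝕜 := ℝ) (E := Euc n) (F := ℂ)
    (n := p)).toContinuousLinearMap

theorem interior_apply {p : ℕ} (a : AltForm n (p + 1)) (v : Euc n) (w : Fin p → Euc n) :
    interior p a v w = a (Matrix.vecCons v w) := rfl

/-- The co-derivative `- ∑ᵢ ∂ᵢ ⌟ ∇_{∂ᵢ} η` of a `(p+1)`-form on `ℝⁿ`. -/
def euclCodiff {p : ℕ} (η : Euc n → AltForm n (p + 1)) (x : Euc n) : AltForm n p :=
  -∑ i : Fin n, interior p (fderiv ℝ η x (stdVec i)) (stdVec i)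

theorem contDiff_euclCodiff {p : ℕ} {η : Euc n → AltForm n (p + 1)}
    (hη : ContDiff ℝ (⊤ : ℕ∞) η) : ContDiff ℝ (⊤ : ℕ∞) (euclCodiff η) := by
  have h1 : ∀ i : Fin n, ContDiff ℝ (⊤ : ℕ∞) fun x => fderiv ℝ η x (stdVec i) := fun i =>
    (hη.fderiv_right (m := (⊤ : ℕ∞)) (by simp)).clm_apply contDiff_const
  have h2 : ∀ i : Fin n, ContDiff ℝ (⊤ : ℕ∞)
      fun x => interior p (fderiv ℝ η x (stdVec i)) (stdVec i) := fun i =>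
    ((interior p).contDiff.comp (h1 i)).clm_apply contDiff_const
  have h3 : ContDiff ℝ (⊤ : ℕ∞)
      fun x => -∑ i : Fin n, interior p (fderiv ℝ η x (stdVec i)) (stdVec i) :=
    (ContDiff.sum fun i _ => h2 i).neg
  exact h3

/-- The co-derivative `δ : Ωᵖ⁺¹ → Ωᵖ`, computed on pullbacks to `ℝⁿ`. It is the formal adjoint
of `d` for the `L²`-scalar product: see `l2Inner_d_left`. -/
def codiff (p : ℕ) : SmoothForm Λ (p + 1) →ₗ[ℂ] SmoothForm Λ p where
  toFun η := descend (euclCodiff (pull η))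
    (contDiff_euclCodiff (contDiff_pull η))
    (fun x v hv => by simp only [euclCodiff, fderiv_pull_add_lattice η x hv])
  map_add' ω η := by
    apply pull_injective
    funext x
    change euclCodiff (pull (ω + η)) x = euclCodiff (pull ω) x + euclCodiff (pull η) x
    simp only [euclCodiff, fderiv_pull_add, add_apply, map_add,
      Finset.sum_add_distrib, neg_add]
  map_smul' c ω := by
    apply pull_injective
    funext x
    change euclCodiff (pull (c • ω)) x = c • euclCodiff (pull ω) x
    have h : ∀ (a : AltForm n (p + 1)) (v : Euc n), interior p (c • a) v = c • interior p a v :=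
      fun _ _ => rfl
    simp only [euclCodiff, fderiv_pull_smul, smul_apply, h,
      Finset.smul_sum, smul_neg]

theorem pull_codiff {p : ℕ} (η : SmoothForm Λ (p + 1)) :
    pull (codiff p η) = euclCodiff (pull η) := rfl

/-- The Hermitian scalar product on `Λᵖ(ℝⁿ)* ⊗ ℂ` induced by the standard metric:
`∑_{i₁ < … < iₚ} a(∂_{i₁}, …, ∂_{iₚ}) conj b(∂_{i₁}, …, ∂_{iₚ})`, written as a sum over all
multi-indices divided by `p!`. -/
def altInner {p : ℕ} (a b : AltForm n p) : ℂ :=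
  ((p.factorial : ℂ))⁻¹ * ∑ I : Fin p → Fin n,
    a (fun k => stdVec (I k)) * (starRingEnd ℂ) (b fun k => stdVec (I k))

theorem contDiff_coeff {p : ℕ} (ω : SmoothForm Λ p) (w : Fin p → Euc n) :
    ContDiff ℝ (⊤ : ℕ∞) fun x => pull ω x w :=
  (ContinuousAlternatingMap.apply ℝ (Euc n) ℂ w).contDiff.comp (contDiff_pull ω)

theorem fderiv_coeff {p : ℕ} (ω : SmoothForm Λ p) (w : Fin p → Euc n) (x v : Euc n) :
    fderiv ℝ (fun x => pull ω x w) x v = fderiv ℝ (pull ω) x v w := by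
  have h := (ContinuousAlternatingMap.apply ℝ (Euc n) ℂ w).hasFDerivAt.comp x
    ((contDiff_pull ω).differentiable (by simp) x).hasFDerivAt
  exact congrFun (congrArg DFunLike.coe h.fderiv) v

theorem altInner_alternatize {p : ℕ} (L : Euc n →L[ℝ] AltForm n p) (b : AltForm n (p + 1)) :
    altInner (ContinuousAlternatingMap.alternatizeUncurryFin L) b =
      ((p.factorial : ℂ))⁻¹ * ∑ I : Fin p → Fin n, ∑ i : Fin n,
        L (stdVec i) (fun k => stdVec (I k)) *
          (starRingEnd ℂ) (b (Matrix.vecCons (stdVec i) fun k => stdVec (I k))) := by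
  have hterm : ∀ k : Fin (p + 1),
      ∑ I : Fin (p + 1) → Fin n, ((-1 : ℤ) ^ (k : ℕ) • L (stdVec (I k))
        (k.removeNth fun j => stdVec (I j))) * (starRingEnd ℂ) (b fun j => stdVec (I j)) =
      ∑ I : Fin p → Fin n, ∑ i : Fin n, L (stdVec i) (fun k => stdVec (I k)) *
          (starRingEnd ℂ) (b (Matrix.vecCons (stdVec i) fun k => stdVec (I k))) := by
    intro k
    rw [← (Fin.insertNthEquiv (fun _ => Fin n) k).sum_comp, Fintype.sum_prod_type,
      Finset.sum_comm]
    refine Finset.sum_congr rfl fun I _ => Finset.sum_congr rfl fun i _ => ?_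
    have h1 : (fun j => (stdVec ((Fin.insertNthEquiv (fun _ => Fin n) k) (i, I) j) : Euc n)) =
        k.insertNth (stdVec i) fun j => stdVec (I j) := by
      funext j
      refine Fin.succAboveCases k ?_ (fun j => ?_) j <;> simp
    rw [h1, ContinuousAlternatingMap.map_insertNth]
    have h2 : (stdVec ((Fin.insertNthEquiv (fun _ => Fin n) k) (i, I) k) : Euc n) = stdVec i := by
      simp
    rw [h2, Fin.removeNth_insertNth]
    have h3 : ((-1 : ℂ) ^ (k : ℕ)) * (-1) ^ (k : ℕ) = 1 := by
      rw [← mul_pow]; simp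
    simp only [zsmul_eq_mul, map_mul, map_pow, map_neg, map_one, Int.cast_pow, Int.cast_neg,
      Int.cast_one]
    linear_combination (L (stdVec i) (fun k => stdVec (I k)) *
      (starRingEnd ℂ) (b (Matrix.vecCons (stdVec i) fun k => stdVec (I k)))) * h3
  unfold altInner
  simp only [ContinuousAlternatingMap.alternatizeUncurryFin_apply, Finset.sum_mul]
  rw [Finset.sum_comm, Finset.sum_congr rfl fun k _ => hterm k, Finset.sum_const,
    Finset.card_univ, Fintype.card_fin, nsmul_eq_mul, Nat.factorial_succ, Nat.cast_mul,
    mul_inv, ← mul_assoc]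
  congr 1
  have : ((p + 1 : ℕ) : ℂ) ≠ 0 := by exact_mod_cast Nat.succ_ne_zero p
  field_simp

section L2

variable [DiscreteTopology Λ] [IsZLattice ℝ Λ]

variable (Λ) in
/-- A fundamental parallelepiped of `Λ`. -/
def fundDomain : Set (Euc n) :=
  ZSpan.fundamentalDomain ((Module.Free.chooseBasis ℤ Λ).ofZLatticeBasis ℝ Λ)

variable (Λ) in
/-- The Riemannian volume measure of `ℝⁿ / Λ`. -/
def torusMeasure : MeasureTheory.Measure (Torus Λ) :=
  MeasureTheory.Measure.map (proj Λ) (MeasureTheory.volume.restrict (fundDomain Λ))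

/-- The `L²`-scalar product of smooth forms on `ℝⁿ / Λ`. -/
def l2Inner {p : ℕ} (ω η : SmoothForm Λ p) : ℂ :=
  ∫ t, altInner (ω.1 t) (η.1 t) ∂(torusMeasure Λ)

open MeasureTheory in
open scoped Pointwise in
theorem setIntegral_add_eq (g : Euc n → ℂ) (hper : ∀ x, ∀ v ∈ Λ, g (x + v) = g x) (v : Euc n) :
    ∫ x in fundDomain Λ, g (x + v) = ∫ x in fundDomain Λ, g x := by
  have hD : IsAddFundamentalDomain Λ (fundDomain Λ) (volume : Measure (Euc n)) :=
    ZLattice.isAddFundamentalDomain (Module.Free.chooseBasis ℤ Λ) volume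
  have hinv : VAddInvariantMeasure Λ (Euc n) volume :=
    inferInstanceAs <| VAddInvariantMeasure Λ.toAddSubgroup (Euc n) volume
  have hD' : IsAddFundamentalDomain Λ (v +ᵥ fundDomain Λ) (volume : Measure (Euc n)) :=
    hD.vadd_of_comm v
  have h1 : ∫ x in fundDomain Λ, g x = ∫ x in v +ᵥ fundDomain Λ, g x := by
    refine hD.setIntegral_eq hD' fun w x => ?_
    rw [Submodule.vadd_def, vadd_eq_add, add_comm]
    exact hper x w w.2
  rw [h1]
  have h2 := (measurePreserving_add_left (volume : Measure (Euc n)) v).setIntegral_image_emb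
    (measurableEmbedding_addLeft v) g (fundDomain Λ)
  have h3 : (fun x => v + x) '' fundDomain Λ = v +ᵥ fundDomain Λ := rfl
  rw [← h3, h2]
  simp only [add_comm]

open MeasureTheory in
theorem integrableOn_fundDomain {g : Euc n → ℂ} (hg : Continuous g) :
    IntegrableOn g (fundDomain Λ) :=
  (hg.continuousOn.integrableOn_compact (ZSpan.fundamentalDomain_isBounded
    ((Module.Free.chooseBasis ℤ Λ).ofZLatticeBasis ℝ Λ)).isCompact_closure).mono_set
    subset_closure

open MeasureTheory in
theorem setIntegral_fderiv_eq_zero {g : Euc n → ℂ} (hg : ContDiff ℝ (⊤ : ℕ∞) g)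
    (hper : ∀ x, ∀ v ∈ Λ, g (x + v) = g x) (v : Euc n) :
    ∫ x in fundDomain Λ, fderiv ℝ g x v = 0 := by
  have hbd : Bornology.IsBounded (fundDomain Λ) := ZSpan.fundamentalDomain_isBounded
    ((Module.Free.chooseBasis ℤ Λ).ofZLatticeBasis ℝ Λ)
  have hmeas : MeasurableSet (fundDomain Λ) := ZSpan.fundamentalDomain_measurableSet _
  obtain ⟨R, hR⟩ := hbd.exists_norm_le
  have hcont : Continuous fun x => fderiv ℝ g x v :=
    (hg.continuous_fderiv (by simp)).clm_apply continuous_const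
  obtain ⟨C, hC⟩ := (isCompact_closedBall (0 : Euc n) (R + ‖v‖)).exists_bound_of_continuousOn
    hcont.continuousOn
  have hfin : volume (fundDomain Λ) < ⊤ := hbd.measure_lt_top
  have : IsFiniteMeasure (volume.restrict (fundDomain Λ)) := ⟨by simpa using hfin⟩
  have hline : ∀ (x : Euc n) (t : ℝ),
      HasDerivAt (fun s : ℝ => g (x + s • v)) (fderiv ℝ g (x + t • v) v) t := by
    intro x t
    have h1 : HasDerivAt (fun s : ℝ => x + s • v) v t := by
      simpa using ((hasDerivAt_id t).smul_const v).const_add x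
    exact ((hg.differentiable (by simp) _).hasFDerivAt).comp_hasDerivAt t h1
  have key := hasDerivAt_integral_of_dominated_loc_of_deriv_le
    (μ := volume.restrict (fundDomain Λ)) (F := fun (t : ℝ) x => g (x + t • v))
    (F' := fun t x => fderiv ℝ g (x + t • v) v) (x₀ := (0 : ℝ)) (s := Metric.ball 0 1)
    (bound := fun _ => C) (Metric.ball_mem_nhds _ one_pos)
    (Filter.Eventually.of_forall fun t =>
      (hg.continuous.comp (continuous_id.add continuous_const)).aestronglyMeasurable)
    (integrableOn_fundDomain (hg.continuous.comp (continuous_id.add continuous_const)))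
    (hcont.comp (continuous_id.add continuous_const)).aestronglyMeasurable
    ((ae_restrict_iff' hmeas).2 (Filter.Eventually.of_forall fun x hx t ht => by
      apply hC
      rw [mem_closedBall_zero_iff]
      have ht' : ‖t‖ ≤ 1 := by simpa using (mem_ball_zero_iff.1 ht).le
      calc ‖x + t • v‖ ≤ ‖x‖ + ‖t • v‖ := norm_add_le _ _
        _ ≤ R + ‖v‖ := by
          rw [norm_smul]
          have := hR x hx
          nlinarith [norm_nonneg v]))
    (integrable_const _)
    (Filter.Eventually.of_forall fun x t _ => hline x t)
  have hconst : (fun t : ℝ => ∫ x in fundDomain Λ, g (x + t • v)) =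
      fun _ => ∫ x in fundDomain Λ, g x := by
    funext t
    exact setIntegral_add_eq g hper (t • v)
  have h0 := key.2
  rw [hconst] at h0
  simpa using h0.unique (hasDerivAt_const (0 : ℝ) _)

theorem l2Inner_eq {p : ℕ} (ω η : SmoothForm Λ p) :
    l2Inner ω η = ∫ x in fundDomain Λ, altInner (pull ω x) (pull η x) := by
  have hc : Continuous fun x => altInner (pull ω x) (pull η x) := by
    unfold altInner
    exact continuous_const.mul (continuous_finsetSum _ fun I _ =>
      (contDiff_coeff ω _).continuous.mul
        (Complex.continuous_conj.comp (contDiff_coeff η _).continuous))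
  have hm : Measurable fun t : Torus Λ => altInner (ω.1 t) (η.1 t) :=
    QuotientAddGroup.measurable_from_quotient.2 hc.measurable
  exact MeasureTheory.integral_map QuotientAddGroup.measurable_coe.aemeasurable
    hm.aestronglyMeasurable

theorem integral_by_parts {f g : Euc n → ℂ} (hf : ContDiff ℝ (⊤ : ℕ∞) f)
    (hg : ContDiff ℝ (⊤ : ℕ∞) g) (hfp : ∀ x, ∀ v ∈ Λ, f (x + v) = f x)
    (hgp : ∀ x, ∀ v ∈ Λ, g (x + v) = g x) (v : Euc n) :
    ∫ x in fundDomain Λ, fderiv ℝ f x v * (starRingEnd ℂ) (g x) =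
      -∫ x in fundDomain Λ, f x * (starRingEnd ℂ) (fderiv ℝ g x v) := by
  have hgc : ContDiff ℝ (⊤ : ℕ∞) fun x => (starRingEnd ℂ) (g x) :=
    Complex.conjCLE.contDiff.comp hg
  have hderiv : ∀ x, fderiv ℝ (fun y => f y * (starRingEnd ℂ) (g y)) x v =
      fderiv ℝ f x v * (starRingEnd ℂ) (g x) + f x * (starRingEnd ℂ) (fderiv ℝ g x v) := by
    intro x
    have h1 := (hf.differentiable (by simp) x).hasFDerivAt
    have h2 : HasFDerivAt (fun y => (starRingEnd ℂ) (g y))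
        ((Complex.conjCLE : ℂ →L[ℝ] ℂ).comp (fderiv ℝ g x)) x :=
      (Complex.conjCLE : ℂ →L[ℝ] ℂ).hasFDerivAt.comp x
        (hg.differentiable (by simp) x).hasFDerivAt
    have h3 := (h1.mul h2).fderiv
    change fderiv ℝ (fun y => f y * (starRingEnd ℂ) (g y)) x = _ at h3
    rw [h3]
    simp
    ring
  have hc1 : Continuous fun x => fderiv ℝ f x v * (starRingEnd ℂ) (g x) :=
    ((hf.continuous_fderiv (by simp)).clm_apply continuous_const).mul hgc.continuous
  have hc2 : Continuous fun x => f x * (starRingEnd ℂ) (fderiv ℝ g x v) :=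
    hf.continuous.mul (Complex.continuous_conj.comp
      ((hg.continuous_fderiv (by simp)).clm_apply continuous_const))
  have h0 := setIntegral_fderiv_eq_zero (Λ := Λ) (hf.mul hgc)
    (fun x w hw => by simp only [hfp x w hw, hgp x w hw]) v
  simp only [hderiv] at h0
  rw [MeasureTheory.integral_add (integrableOn_fundDomain hc1) (integrableOn_fundDomain hc2)] at h0
  exact eq_neg_of_add_eq_zero_left h0

/-- `δ` is the formal adjoint of `d`: `(dω, η) = (ω, δη)`. -/
theorem l2Inner_d_left {p : ℕ} (ω : SmoothForm Λ p) (η : SmoothForm Λ (p + 1)) :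
    l2Inner (d p ω) η = l2Inner ω (codiff p η) := by
  rw [l2Inner_eq, l2Inner_eq]
  simp only [pull_d, extDeriv, altInner_alternatize, pull_codiff]
  unfold altInner
  rw [MeasureTheory.integral_const_mul, MeasureTheory.integral_const_mul]
  congr 1
  have hcd : ∀ (I : Fin p → Fin n) (x : Euc n),
      (starRingEnd ℂ) (euclCodiff (pull η) x fun k => stdVec (I k)) =
      -∑ i : Fin n, (starRingEnd ℂ) (fderiv ℝ (fun y => pull η y
        (Matrix.vecCons (stdVec i) fun k => stdVec (I k))) x (stdVec i)) := by
    intro I x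
    rw [← map_sum, ← map_neg]
    congr 1
    simp only [fderiv_coeff]
    simp [euclCodiff, interior_apply]
  simp only [hcd, ← fderiv_coeff, mul_neg, Finset.mul_sum]
  have hc1 : ∀ (I : Fin p → Fin n) (i : Fin n), Continuous fun x =>
      fderiv ℝ (fun y => pull ω y fun k => stdVec (I k)) x (stdVec i) *
        (starRingEnd ℂ) (pull η x (Matrix.vecCons (stdVec i) fun k => stdVec (I k))) := fun I i =>
    (((contDiff_coeff ω _).continuous_fderiv (by simp)).clm_apply continuous_const).mul
      (Complex.continuous_conj.comp (contDiff_coeff η _).continuous)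
  have hc2 : ∀ (I : Fin p → Fin n) (i : Fin n), Continuous fun x =>
      (pull ω x fun k => stdVec (I k)) * (starRingEnd ℂ) (fderiv ℝ (fun y => pull η y
        (Matrix.vecCons (stdVec i) fun k => stdVec (I k))) x (stdVec i)) := fun I i =>
    (contDiff_coeff ω _).continuous.mul (Complex.continuous_conj.comp
      (((contDiff_coeff η _).continuous_fderiv (by simp)).clm_apply continuous_const))
  rw [MeasureTheory.integral_finsetSum _ fun I _ => integrableOn_fundDomain
      (continuous_finsetSum _ fun i _ => hc1 I i),
    MeasureTheory.integral_finsetSum (f := fun (I : Fin p → Fin n) x => -∑ i : Fin n,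
      (pull ω x fun k => stdVec (I k)) * (starRingEnd ℂ) (fderiv ℝ (fun y => pull η y
        (Matrix.vecCons (stdVec i) fun k => stdVec (I k))) x (stdVec i))) _
      fun I _ => integrableOn_fundDomain (continuous_finsetSum _ fun i _ => hc2 I i).neg]
  refine Finset.sum_congr rfl fun I _ => ?_
  rw [MeasureTheory.integral_neg,
    MeasureTheory.integral_finsetSum _ fun i _ => integrableOn_fundDomain (hc1 I i),
    MeasureTheory.integral_finsetSum _ fun i _ => integrableOn_fundDomain (hc2 I i),
    ← Finset.sum_neg_distrib]
  refine Finset.sum_congr rfl fun i _ => ?_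
  exact integral_by_parts (contDiff_coeff ω _) (contDiff_coeff η _)
    (fun x v hv => by rw [pull_add_lattice ω x hv])
    (fun x v hv => by rw [pull_add_lattice η x hv]) (stdVec i)

end L2

/-- The operator `F_{αβ,p} = α d δ + β δ d` on `Ωᵖ(ℝⁿ/Λ, ℂ)`, where `δ = 0` on functions. -/
def F (Λ : Submodule ℤ (Euc n)) (α β : ℝ) : (p : ℕ) → Module.End ℂ (SmoothForm Λ p)
  | 0 => (β : ℂ) • (codiff 0 ∘ₗ d 0 : SmoothForm Λ 0 →ₗ[ℂ] SmoothForm Λ 0)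
  | p + 1 =>
    (α : ℂ) • (d p ∘ₗ codiff p : SmoothForm Λ (p + 1) →ₗ[ℂ] SmoothForm Λ (p + 1)) +
    (β : ℂ) • (codiff (p + 1) ∘ₗ d (p + 1) : SmoothForm Λ (p + 1) →ₗ[ℂ] SmoothForm Λ (p + 1))

/-- The eigenspace `Eig(F_{αβ,p}, μ)` of smooth forms `ω` with `F_{αβ,p} ω = μ ω`. -/
def Eig (Λ : Submodule ℤ (Euc n)) (α β : ℝ) (p : ℕ) (μ : ℂ) : Submodule ℂ (SmoothForm Λ p) :=
  Module.End.eigenspace (R := ℂ) (M := SmoothForm Λ p) (F Λ α β p) μ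

/-- The spectrum of `F_{αβ,p}`, as a weighted set: it assigns to `μ` the dimension of the
eigenspace for `μ`. -/
def Spec (Λ : Submodule ℤ (Euc n)) (α β : ℝ) (p : ℕ) (μ : ℂ) : Cardinal :=
  Module.rank ℂ (Eig Λ α β p μ)

/-- Two operators `F_{αβ,p}` and `F_{α'β',p}` on `ℝⁿ/Λ` are isospectral if they have the same
eigenvalues with the same multiplicities. -/
def Isospectral (Λ : Submodule ℤ (Euc n)) (p : ℕ) (α β α' β' : ℝ) : Prop :=
  Spec Λ α β p = Spec Λ α' β' p

end FlatTorus

end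

/-! Fourier expansion reduces the spectrum to linear algebra at each frequency. On forms with
frequency `k` in the dual lattice, `F` acts as `4π²` times the symbol `α k∧(k⌟·) + β k⌟(k∧·)`
(`formCoef_F`). The identity `k⌟(k∧a) + k∧(k⌟a) = ‖k‖² a` (`contract_wedge_add`) splits the forms,
for `k ≠ 0`, into the kernels of `k∧` and `k⌟`; on these the symbol is the scalar `α‖k‖²`,
respectively `β‖k‖²`.

In degree `p + 1` the kernels have dimensions `A = C(n-1, p)` and `B = C(n-1, p+1)`. Let `N r` be
the number of dual lattice vectors with squared norm `r`. Then `4π²ν` has multiplicity `A N(ν/α) + B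
N(ν/β)` (`Spec_eq_freqCount`). The frequency `0` fits this formula, since `A + B = C(n, p+1)`.

To recover the parameters, let `s` be the least positive value with `N s > 0`. For `A, B > 0` the
first positive eigenvalue corresponds to `ν = s min(α, β)` and so determines the minimum. Its
multiplicity is `A`, `B` or `A + B` times `N s`; if `A ≠ B`, this tells which parameter attains the
minimum. Cancelling the known term leaves a count with one parameter, which is determined by its own
first eigenvalue. If `A = B`, which is the middle degree, the formula is symmetric and only the
unordered pair survives. In top degree `B = 0` and `β` drops out. -/

noncomputable section

namespace FlatTorus

/-! ### Linear algebra of a homotopy identity `c'w' + wc = s` -/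

section Cartan

variable {K U V W : Type*} [Field K] [AddCommGroup U] [AddCommGroup V] [AddCommGroup W]
  [Module K U] [Module K V] [Module K W] {c : V →ₗ[K] U} {w : U →ₗ[K] V} {w' : V →ₗ[K] W}
  {c' : W →ₗ[K] V} {s : K}

theorem isCompl_ker_of_homotopy (hs : s ≠ 0) (hc : ∀ x, c (c' x) = 0) (hw : ∀ x, w' (w x) = 0)
    (h : ∀ a, c' (w' a) + w (c a) = s • a) : IsCompl (LinearMap.ker w') (LinearMap.ker c) := by
  constructor
  · rw [Submodule.disjoint_def]
    intro a h1 h2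
    have h := h a
    rw [LinearMap.mem_ker.1 h1, LinearMap.mem_ker.1 h2, map_zero, map_zero, add_zero] at h
    exact (smul_eq_zero.1 h.symm).resolve_left hs
  · rw [codisjoint_iff, Submodule.eq_top_iff']
    intro a
    have h : a = s⁻¹ • w (c a) + s⁻¹ • c' (w' a) := by
      rw [← smul_add, add_comm (w _), h, inv_smul_smul₀ hs]
    rw [h]
    exact Submodule.add_mem_sup (Submodule.smul_mem _ _ (hw _)) (Submodule.smul_mem _ _ (hc _))

/-- Applying `c` to the eigenvalue equation kills the `β` term and multiplies `c a` by `α s`;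
applying `w'` kills the `α` term and multiplies `w' a` by `β s`. Conversely, the homotopy identity
rebuilds `ν • a` from the two pieces. -/
theorem mem_eigenspace_of_homotopy (hs : s ≠ 0) (hc : ∀ x, c (c' x) = 0)
    (hw : ∀ x, w' (w x) = 0) (h : ∀ a, c' (w' a) + w (c a) = s • a) (α β ν : K) (a : V) :
    α • w (c a) + β • c' (w' a) = ν • a ↔
      (ν = α * s ∨ c a = 0) ∧ (ν = β * s ∨ w' a = 0) := by
  have hcP : c (w (c a)) = s • c a := by
    have := congrArg c (h a)
    rwa [map_add, hc, zero_add, map_smul] at this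
  have hwQ : w' (c' (w' a)) = s • w' a := by
    have := congrArg w' (h a)
    rwa [map_add, hw, add_zero, map_smul] at this
  constructor
  · intro e
    have h1 := congrArg c e
    have h2 := congrArg w' e
    simp only [map_add, map_smul, hcP, hwQ, hc, hw, smul_zero, add_zero, zero_add] at h1 h2
    rw [smul_smul, ← sub_eq_zero, ← sub_smul, smul_eq_zero, sub_eq_zero] at h1 h2
    exact ⟨h1.imp Eq.symm id, h2.imp Eq.symm id⟩
  · rintro ⟨h1, h2⟩
    have key : ν • a = s⁻¹ • ν • (c' (w' a) + w (c a)) := by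
      rw [h, smul_comm s⁻¹, inv_smul_smul₀ hs]
    have e1 : s⁻¹ • ν • w (c a) = α • w (c a) := by
      rcases h1 with h1 | h1
      · rw [h1, smul_smul]
        congr 1
        field_simp
      · simp [h1]
    have e2 : s⁻¹ • ν • c' (w' a) = β • c' (w' a) := by
      rcases h2 with h2 | h2
      · rw [h2, smul_smul]
        congr 1
        field_simp
      · simp [h2]
    rw [key, smul_add, smul_add, e1, e2, add_comm]

end Cartan

/-! ### The symbol on alternating forms: Cartan's identity and eigenspace dimensions -/

section Symbol

variable {n : ℕ}

/-- Exterior multiplication `a ↦ k ∧ a` by the covector dual to `k`. -/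
def wedge (p : ℕ) (k : Euc n) : AltForm n p →ₗ[ℂ] AltForm n (p + 1) where
  toFun a := ContinuousAlternatingMap.alternatizeUncurryFin ((innerSL ℝ k).smulRight a)
  map_add' a b := by
    rw [← ContinuousAlternatingMap.alternatizeUncurryFin_add]
    congr 1
    ext v w
    simp
  map_smul' c a := by
    rw [RingHom.id_apply, ← ContinuousAlternatingMap.alternatizeUncurryFin_smul]
    congr 1
    ext v w
    simp
    ring

/-- Interior multiplication `a ↦ k ⌟ a`, as a complex linear map. -/
def contract (p : ℕ) (k : Euc n) : AltForm n (p + 1) →ₗ[ℂ] AltForm n p where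
  toFun a := interior p a k
  map_add' a b := by simp
  map_smul' _ _ := rfl

theorem wedge_apply {p : ℕ} (k : Euc n) (a : AltForm n p) (v : Fin (p + 1) → Euc n) :
    wedge p k a v = ∑ i : Fin (p + 1), (-1 : ℤ) ^ (i : ℕ) • (inner ℝ k (v i) • a (i.removeNth v)) := by
  simp only [wedge, LinearMap.coe_mk, AddHom.coe_mk,
    ContinuousAlternatingMap.alternatizeUncurryFin_apply]
  rfl

theorem contract_apply {p : ℕ} (k : Euc n) (a : AltForm n (p + 1)) (v : Fin p → Euc n) :
    contract p k a v = a (Matrix.vecCons k v) := rfl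

theorem contract_contract {p : ℕ} (k : Euc n) (a : AltForm n (p + 2)) :
    contract p k (contract (p + 1) k a) = 0 := by
  ext v
  simp only [contract_apply]
  exact a.map_eq_zero_of_eq _ (i := 0) (j := 1) (by simp) (by simp)

/-- The argument is that of `d² = 0`: the bilinear map `(x, y) ↦ ⟨k, x⟩⟨k, y⟩ a` is symmetric, and
alternating twice annihilates symmetric maps. -/
theorem wedge_wedge {p : ℕ} (k : Euc n) (a : AltForm n p) :
    wedge (p + 1) k (wedge p k a) = 0 := by
  have h := ContinuousAlternatingMap.alternatizeUncurryFin_alternatizeUncurryFinCLM_comp_of_symmetric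
    (𝕜 := ℝ) (f := (innerSL ℝ k).smulRight ((innerSL ℝ k).smulRight a)) (fun x y => by
      ext w
      simp
      ring)
  rw [← h]
  change ContinuousAlternatingMap.alternatizeUncurryFin _ = _
  congr 1
  ext x w
  simp [wedge, ContinuousAlternatingMap.alternatizeUncurryFin_apply, Finset.mul_sum]

theorem contract_wedge_zero (k : Euc n) (a : AltForm n 0) :
    contract 0 k (wedge 0 k a) = ((‖k‖ ^ 2 : ℝ) : ℂ) • a := by
  ext v
  rw [contract_apply, wedge_apply]
  have : (Fin.removeNth 0 (Matrix.vecCons k v)) = v := Subsingleton.elim _ _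
  simp [this]

/-- The symbol of Cartan's formula `dδ + δd = Δ`. -/
theorem contract_wedge_add {p : ℕ} (k : Euc n) (a : AltForm n (p + 1)) :
    contract (p + 1) k (wedge (p + 1) k a) + wedge p k (contract p k a) =
      ((‖k‖ ^ 2 : ℝ) : ℂ) • a := by
  ext v
  rw [ContinuousAlternatingMap.add_apply, contract_apply, wedge_apply, wedge_apply,
    Fin.sum_univ_succ]
  have h0 : Fin.removeNth 0 (Matrix.vecCons k v) = v := by
    funext j; simp [Fin.removeNth]
  have h1 : ∀ i : Fin (p + 1), Fin.removeNth i.succ (Matrix.vecCons k v) =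
      Matrix.vecCons k (i.removeNth v) := by
    intro i
    funext j
    refine Fin.cases ?_ (fun j => ?_) j <;> simp [Fin.removeNth]
  simp only [h0, h1, contract_apply]
  -- The summand of index `0` already gives `‖k‖² a`. The other summands of `k⌟(k∧a)` cancel those
  -- of `k∧(k⌟a)` one by one, because the index is shifted by one and so the sign flips.
  rw [add_assoc, ← Finset.sum_add_distrib, Finset.sum_eq_zero]
  · simp
  · intro i _
    simp [pow_succ]

/-- Expanding each argument in the standard basis exhibits the map as a polynomial in the
coordinates. -/
theorem _root_.AlternatingMap.continuous_of_euclidean {p : ℕ} (f : Euc n [⋀^Fin p]→ₗ[ℝ] ℂ) :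
    Continuous f := by
  classical
  have h : ∀ v : Fin p → Euc n,
      f v = ∑ I : Fin p → Fin n, (∏ j, v j (I j)) • f fun j => stdVec (I j) := by
    intro v
    have hv : v = fun j => ∑ i, v j i • (stdVec i : Euc n) := by
      funext j
      ext l
      simp [Pi.single_apply]
    conv_lhs => rw [hv]
    have h1 := f.toMultilinearMap.map_sum (fun j i => v j i • (stdVec i : Euc n))
    refine h1.trans (Finset.sum_congr rfl fun I _ => ?_)
    exact f.toMultilinearMap.map_smul_univ (fun j => v j (I j)) fun j => stdVec (I j)
  have h2 : (f : (Fin p → Euc n) → ℂ) =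
      fun v => ∑ I : Fin p → Fin n, (∏ j, v j (I j)) • f fun j => stdVec (I j) := funext h
  rw [h2]
  fun_prop

/-- On `ℝⁿ`, every alternating map is continuous and factors through the exterior power. -/
def altFormEquiv (n p : ℕ) : AltForm n p ≃ₗ[ℂ] (⋀[ℝ]^p (Euc n) →ₗ[ℝ] ℂ) where
  toFun a := exteriorPower.alternatingMapLinearEquiv a.toAlternatingMap
  map_add' a b := by
    rw [← map_add]
    rfl
  map_smul' c a := by
    apply exteriorPower.linearMap_ext
    ext v
    simp
  invFun f :=
    { exteriorPower.alternatingMapLinearEquiv.symm f with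
      cont := AlternatingMap.continuous_of_euclidean _ }
  left_inv a := by
    ext v
    change exteriorPower.alternatingMapLinearEquiv.symm
      (exteriorPower.alternatingMapLinearEquiv a.toAlternatingMap) v = a v
    rw [LinearEquiv.symm_apply_apply]
    rfl
  right_inv f := by
    refine Eq.trans ?_ (exteriorPower.alternatingMapLinearEquiv.apply_symm_apply f)
    rfl

theorem finrank_altForm (n p : ℕ) : Module.finrank ℂ (AltForm n p) = n.choose p := by
  rw [(altFormEquiv n p).finrank_eq, Module.finrank_linearMap, exteriorPower.finrank_eq]
  simp

instance finiteDimensional_altForm (n p : ℕ) : FiniteDimensional ℂ (AltForm n p) :=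
  Module.Finite.equiv (altFormEquiv n p).symm

theorem isCompl_ker_wedge_ker_contract (p : ℕ) {k : Euc n} (hk : k ≠ 0) :
    IsCompl (LinearMap.ker (wedge (p + 1) k)) (LinearMap.ker (contract p k)) :=
  isCompl_ker_of_homotopy (s := ((‖k‖ ^ 2 : ℝ) : ℂ)) (by simpa using hk)
    (contract_contract k) (wedge_wedge k) (contract_wedge_add k)

theorem ker_wedge_eq_range (p : ℕ) {k : Euc n} (hk : k ≠ 0) :
    LinearMap.ker (wedge (p + 1) k) = LinearMap.range (wedge p k) := by
  have hs : ((‖k‖ ^ 2 : ℝ) : ℂ) ≠ 0 := by simpa using hk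
  apply le_antisymm
  · intro a ha
    have h := contract_wedge_add k a
    rw [LinearMap.mem_ker.1 ha, map_zero, zero_add] at h
    refine ⟨((‖k‖ ^ 2 : ℝ) : ℂ)⁻¹ • contract p k a, ?_⟩
    rw [map_smul, h, inv_smul_smul₀ hs]
  · rintro _ ⟨a, rfl⟩
    exact wedge_wedge k a

theorem ker_wedge_zero {k : Euc n} (hk : k ≠ 0) : LinearMap.ker (wedge 0 k) = ⊥ := by
  have hs : ((‖k‖ ^ 2 : ℝ) : ℂ) ≠ 0 := by simpa using hk
  rw [LinearMap.ker_eq_bot']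
  intro a ha
  have h := contract_wedge_zero k a
  rw [ha, map_zero] at h
  exact (smul_eq_zero.1 h.symm).resolve_left hs

/-- The complex with differential `k∧` is exact for `k ≠ 0`, so rank-nullity gives the dimensions
recursively and Pascal's rule solves the recursion. A nonzero `k` forces `n ≠ 0`, so `n - 1` is not
truncated. -/
theorem finrank_ker_wedge (p : ℕ) {k : Euc n} (hk : k ≠ 0) :
    Module.finrank ℂ (LinearMap.ker (wedge (p + 1) k)) = (n - 1).choose p := by
  obtain ⟨m, rfl⟩ : ∃ m, n = m + 1 := by
    refine Nat.exists_eq_succ_of_ne_zero fun h => hk ?_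
    subst h
    exact Subsingleton.elim _ _
  rw [Nat.add_sub_cancel]
  induction p with
  | zero =>
    have h := LinearMap.finrank_range_add_finrank_ker (wedge 0 k)
    rw [ker_wedge_zero hk, finrank_bot, finrank_altForm] at h
    rw [ker_wedge_eq_range 0 hk]
    simpa using h
  | succ p ih =>
    have h := LinearMap.finrank_range_add_finrank_ker (wedge (p + 1) k)
    rw [ih, finrank_altForm, Nat.choose_succ_succ] at h
    rw [ker_wedge_eq_range (p + 1) hk]
    simp only [Nat.succ_eq_add_one] at h
    omega

theorem finrank_ker_contract (p : ℕ) {k : Euc n} (hk : k ≠ 0) :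
    Module.finrank ℂ (LinearMap.ker (contract p k)) = (n - 1).choose (p + 1) := by
  have h := Submodule.finrank_add_eq_of_isCompl (isCompl_ker_wedge_ker_contract p hk)
  obtain ⟨m, rfl⟩ : ∃ m, n = m + 1 := by
    refine Nat.exists_eq_succ_of_ne_zero fun h => hk ?_
    subst h
    exact Subsingleton.elim _ _
  rw [finrank_ker_wedge p hk, finrank_altForm, Nat.choose_succ_succ] at h
  simp only [Nat.succ_eq_add_one, Nat.add_sub_cancel] at h ⊢
  omega

/-- The symbol of `α d δ + β δ d` at the covector `k`. -/
def symbol (α β : ℝ) (p : ℕ) (k : Euc n) : Module.End ℂ (AltForm n (p + 1)) :=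
  (α : ℂ) • (wedge p k ∘ₗ contract p k) + (β : ℂ) • (contract (p + 1) k ∘ₗ wedge (p + 1) k)

theorem symbol_apply (α β : ℝ) (p : ℕ) (k : Euc n) (a : AltForm n (p + 1)) :
    symbol α β p k a =
      (α : ℂ) • wedge p k (contract p k a) + (β : ℂ) • contract (p + 1) k (wedge (p + 1) k a) :=
  rfl

theorem symbol_zero (α β : ℝ) (p : ℕ) : symbol α β p (0 : Euc n) = 0 := by
  have h : ∀ q, contract q (0 : Euc n) = 0 := by
    intro q
    ext a v
    rw [contract_apply]
    exact a.map_coord_zero 0 rfl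
  rw [symbol, h, h, LinearMap.comp_zero, LinearMap.zero_comp, smul_zero, smul_zero, add_zero]

theorem mem_eigenspace_symbol_iff (α β : ℝ) (p : ℕ) {k : Euc n} (hk : k ≠ 0) (ν : ℂ)
    (a : AltForm n (p + 1)) :
    a ∈ Module.End.eigenspace (symbol α β p k) ν ↔
      (ν = ((α * ‖k‖ ^ 2 : ℝ) : ℂ) ∨ contract p k a = 0) ∧
      (ν = ((β * ‖k‖ ^ 2 : ℝ) : ℂ) ∨ wedge (p + 1) k a = 0) := by
  rw [Module.End.mem_eigenspace_iff, symbol_apply, Complex.ofReal_mul, Complex.ofReal_mul]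
  exact mem_eigenspace_of_homotopy (by simpa using hk) (contract_contract k) (wedge_wedge k)
    (contract_wedge_add k) _ _ _ _

theorem finrank_congr {K V : Type*} [Field K] [AddCommGroup V] [Module K V]
    {A B : Submodule K V} (h : A = B) : Module.finrank K A = Module.finrank K B := by rw [h]

-- The contributions add because both conditions can hold at once, namely when `α = β` or `k = 0`.
open Classical in
theorem finrank_eigenspace_symbol (hn : n ≠ 0) (α β : ℝ) (p : ℕ) (k : Euc n) (ν : ℂ) :
    Module.finrank ℂ (Module.End.eigenspace (symbol α β p k) ν) =
      (if ν = ((α * ‖k‖ ^ 2 : ℝ) : ℂ) then (n - 1).choose p else 0) +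
      (if ν = ((β * ‖k‖ ^ 2 : ℝ) : ℂ) then (n - 1).choose (p + 1) else 0) := by
  have htop : Module.finrank ℂ (⊤ : Submodule ℂ (AltForm n (p + 1))) =
      (n - 1).choose p + (n - 1).choose (p + 1) := by
    obtain ⟨m, rfl⟩ := Nat.exists_eq_succ_of_ne_zero hn
    rw [finrank_top, finrank_altForm, Nat.succ_eq_add_one, Nat.choose_succ_succ,
      Nat.add_sub_cancel]
  -- At `k = 0` there is no splitting, but the symbol vanishes, both conditions read `ν = 0`, and
  -- Pascal's rule makes the sum the full dimension.
  rcases eq_or_ne k 0 with rfl | hk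
  · rw [symbol_zero]
    by_cases hν : ν = 0
    · have h : Module.End.eigenspace (0 : Module.End ℂ (AltForm n (p + 1))) ν = ⊤ := by
        rw [Submodule.eq_top_iff']
        intro a
        simp [hν]
      rw [h, htop]
      simp [hν]
    · have h : Module.End.eigenspace (0 : Module.End ℂ (AltForm n (p + 1))) ν = ⊥ := by
        rw [Submodule.eq_bot_iff]
        intro a ha
        rw [Module.End.mem_eigenspace_iff] at ha
        exact (smul_eq_zero.1 ha.symm).resolve_left hν
      rw [h, finrank_bot]
      simp [hν]
  · have hd := (isCompl_ker_wedge_ker_contract p hk).disjoint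
    by_cases h1 : ν = ((α * ‖k‖ ^ 2 : ℝ) : ℂ) <;> by_cases h2 : ν = ((β * ‖k‖ ^ 2 : ℝ) : ℂ)
    · rw [if_pos h1, if_pos h2, ← htop]
      apply finrank_congr
      ext a
      simp only [mem_eigenspace_symbol_iff α β p hk, h1.symm, h2.symm, true_or, and_self,
        Submodule.mem_top]
    · rw [if_pos h1, if_neg h2, ← finrank_ker_wedge p hk, add_zero]
      apply finrank_congr
      ext a
      simp only [mem_eigenspace_symbol_iff α β p hk, h1, true_or, true_and, LinearMap.mem_ker]
      rw [← h1]
      simp only [h2, false_or]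
    · rw [if_neg h1, if_pos h2, ← finrank_ker_contract p hk, zero_add]
      apply finrank_congr
      ext a
      simp only [mem_eigenspace_symbol_iff α β p hk, h2, true_or, and_true, LinearMap.mem_ker]
      rw [← h2]
      simp only [h1, false_or]
    · rw [if_neg h1, if_neg h2, add_zero]
      refine Submodule.finrank_eq_zero.2 ((Submodule.eq_bot_iff _).2 fun a ha => ?_)
      rw [mem_eigenspace_symbol_iff α β p hk] at ha
      exact (Submodule.disjoint_def.1 hd) a (ha.2.resolve_left h2) (ha.1.resolve_left h1)

end Symbol

end FlatTorus

end

noncomputable section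

namespace FlatTorus

/-! ### Characters of the torus and uniqueness of Fourier coefficients -/

section Fourier

variable {n : ℕ} (Λ : Submodule ℤ (Euc n)) [DiscreteTopology Λ] [IsZLattice ℝ Λ]

/-- An index type for a basis of the lattice. -/
abbrev LatticeIndex : Type := Module.Free.ChooseBasisIndex ℤ Λ

/-- A basis of `ℝⁿ` that spans `Λ` over `ℤ`. -/
def latticeBasis : Module.Basis (LatticeIndex Λ) ℝ (Euc n) :=
  (Module.Free.chooseBasis ℤ Λ).ofZLatticeBasis ℝ Λ

/-- The vector of the dual lattice with given integral coordinates in the dual basis. -/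
def freq (m : LatticeIndex Λ → ℤ) : Euc n :=
  (InnerProductSpace.toDual ℝ (Euc n)).symm
    (LinearMap.toContinuousLinearMap (∑ i, (m i : ℝ) • (latticeBasis Λ).coord i))

theorem inner_freq (m : LatticeIndex Λ → ℤ) (x : Euc n) :
    inner ℝ (freq Λ m) x = ∑ i, (m i : ℝ) * (latticeBasis Λ).repr x i := by
  rw [freq, InnerProductSpace.toDual_symm_apply]
  simp

theorem inner_freq_basis (m : LatticeIndex Λ → ℤ) (i : LatticeIndex Λ) :
    inner ℝ (freq Λ m) (latticeBasis Λ i) = m i := by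
  classical
  simp [inner_freq, Finsupp.single_apply]

theorem mem_lattice_iff (v : Euc n) :
    v ∈ Λ ↔ ∀ i, ∃ a : ℤ, (a : ℝ) = (latticeBasis Λ).repr v i := by
  conv_lhs => rw [← (Module.Free.chooseBasis ℤ Λ).ofZLatticeBasis_span ℝ Λ]
  exact Module.Basis.mem_span_iff_repr_mem ℤ (latticeBasis Λ) v

theorem exists_inner_freq_eq (m : LatticeIndex Λ → ℤ) {v : Euc n} (hv : v ∈ Λ) :
    ∃ a : ℤ, inner ℝ (freq Λ m) v = a := by
  choose a ha using (mem_lattice_iff Λ v).1 hv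
  refine ⟨∑ i, m i * a i, ?_⟩
  rw [inner_freq]
  push_cast
  simp only [ha]

/-- The character of `ℝⁿ / Λ` of a given frequency, as a function on `ℝⁿ`. -/
def wave (m : LatticeIndex Λ → ℤ) (x : Euc n) : ℂ :=
  Complex.exp (2 * Real.pi * Complex.I * (inner ℝ (freq Λ m) x : ℝ))

theorem hasFDerivAt_wave (m : LatticeIndex Λ → ℤ) (x : Euc n) :
    HasFDerivAt (wave Λ m)
      (wave Λ m x • (2 * Real.pi * Complex.I) • Complex.ofRealCLM.comp (innerSL ℝ (freq Λ m))) x :=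
  (((Complex.ofRealCLM.comp (innerSL ℝ (freq Λ m))).hasFDerivAt (x := x)).const_mul
    (2 * Real.pi * Complex.I)).cexp

theorem fderiv_wave (m : LatticeIndex Λ → ℤ) (x v : Euc n) :
    fderiv ℝ (wave Λ m) x v =
      2 * Real.pi * Complex.I * (inner ℝ (freq Λ m) v : ℝ) * wave Λ m x := by
  rw [(hasFDerivAt_wave Λ m x).fderiv]
  simp
  ring

theorem contDiff_wave (m : LatticeIndex Λ → ℤ) : ContDiff ℝ (⊤ : ℕ∞) (wave Λ m) :=
  (contDiff_const.mul (Complex.ofRealCLM.comp (innerSL ℝ (freq Λ m))).contDiff).cexp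

theorem wave_add_lattice (m : LatticeIndex Λ → ℤ) (x : Euc n) {v : Euc n} (hv : v ∈ Λ) :
    wave Λ m (x + v) = wave Λ m x := by
  obtain ⟨a, ha⟩ := exists_inner_freq_eq Λ m hv
  rw [wave, wave, inner_add_right, ha, Complex.exp_eq_exp_iff_exists_int]
  exact ⟨a, by push_cast; ring⟩

theorem wave_mul_conj (m : LatticeIndex Λ → ℤ) (x : Euc n) :
    wave Λ m x * (starRingEnd ℂ) (wave Λ m x) = 1 := by
  rw [wave, ← Complex.exp_conj, ← Complex.exp_add, Complex.exp_eq_one_iff]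
  exact ⟨0, by simp [map_ofNat]⟩

open MeasureTheory

/-- The (unnormalised) Fourier coefficient of a function. -/
def fourierCoef (m : LatticeIndex Λ → ℤ) (f : Euc n → ℂ) : ℂ :=
  ∫ x in fundDomain Λ, f x * (starRingEnd ℂ) (wave Λ m x)

variable {Λ}

/-- Integration by parts moves the derivative onto the conjugate character; its minus sign cancels
the one from conjugating `2πi`. -/
theorem fourierCoef_fderiv (m : LatticeIndex Λ → ℤ) {f : Euc n → ℂ}
    (hf : ContDiff ℝ (⊤ : ℕ∞) f) (hfp : ∀ x, ∀ v ∈ Λ, f (x + v) = f x) (v : Euc n) :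
    fourierCoef Λ m (fun x => fderiv ℝ f x v) =
      2 * Real.pi * Complex.I * (inner ℝ (freq Λ m) v : ℝ) * fourierCoef Λ m f := by
  unfold fourierCoef
  rw [integral_by_parts hf (contDiff_wave Λ m) hfp
    (fun x w hw => wave_add_lattice Λ m x hw), ← integral_neg, ← integral_const_mul]
  congr 1
  funext x
  rw [fderiv_wave]
  simp [map_ofNat]
  ring

theorem continuous_wave (m : LatticeIndex Λ → ℤ) : Continuous (wave Λ m) :=
  (contDiff_wave Λ m).continuous

theorem integrableOn_mul_conj_wave (m : LatticeIndex Λ → ℤ) {f : Euc n → ℂ} (hf : Continuous f) :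
    IntegrableOn (fun x => f x * (starRingEnd ℂ) (wave Λ m x)) (fundDomain Λ) :=
  integrableOn_fundDomain (hf.mul (Complex.continuous_conj.comp (continuous_wave m)))

theorem fourierCoef_sum {κ : Type*} (s : Finset κ) (m : LatticeIndex Λ → ℤ) (c : κ → ℂ)
    {f : κ → Euc n → ℂ} (hf : ∀ i, Continuous (f i)) :
    fourierCoef Λ m (fun x => ∑ i ∈ s, c i * f i x) = ∑ i ∈ s, c i * fourierCoef Λ m (f i) := by
  unfold fourierCoef
  simp only [Finset.sum_mul, mul_assoc]
  rw [integral_finsetSum _ fun i _ => (integrableOn_mul_conj_wave m (hf i)).const_mul (c i)]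
  simp only [integral_const_mul]

/-- Differentiating along a basis vector where `m` and `m'` differ multiplies the coefficient by
`2πi m' i` and, by parts, also by `2πi m i`; hence it vanishes. -/
theorem fourierCoef_wave_of_ne {m m' : LatticeIndex Λ → ℤ} (h : m ≠ m') :
    fourierCoef Λ m (wave Λ m') = 0 := by
  obtain ⟨i, hi⟩ := Function.ne_iff.1 h
  have h1 := fourierCoef_fderiv m (contDiff_wave Λ m')
    (fun x w hw => wave_add_lattice Λ m' x hw) (latticeBasis Λ i)
  simp only [fderiv_wave, inner_freq_basis] at h1
  -- A sum over one index serves as homogeneity of the Fourier coefficient.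
  have h2 := fourierCoef_sum {()} m
    (fun _ => 2 * Real.pi * Complex.I * ((m' i : ℝ) : ℂ)) (f := fun _ => wave Λ m')
    (fun _ => continuous_wave m')
  simp only [Finset.sum_singleton] at h2
  rw [h2, ← sub_eq_zero, ← sub_mul, mul_eq_zero] at h1
  refine h1.resolve_left fun h3 => ?_
  rw [← mul_sub, mul_eq_zero] at h3
  have h4 : (2 * Real.pi * Complex.I : ℂ) ≠ 0 := Complex.two_pi_I_ne_zero
  have h5 := sub_eq_zero.1 (h3.resolve_left h4)
  exact hi (by exact_mod_cast h5.symm)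

theorem fourierCoef_wave_self (m : LatticeIndex Λ → ℤ) :
    fourierCoef Λ m (wave Λ m) = (volume.real (fundDomain Λ) : ℂ) := by
  simp [fourierCoef, wave_mul_conj]

theorem volume_fundDomain_ne_zero : volume.real (fundDomain Λ) ≠ 0 := by
  have h1 : volume (fundDomain Λ) ≠ 0 := ZSpan.measure_fundamentalDomain_ne_zero _
  have h2 : volume (fundDomain Λ) ≠ ⊤ :=
    (ZSpan.fundamentalDomain_isBounded _).measure_lt_top.ne
  exact ENNReal.toReal_ne_zero.2 ⟨h1, h2⟩

variable (Λ) in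
/-- The projection to the standard torus in the coordinates of a basis of the lattice. -/
def toUnitTorus (x : Euc n) : UnitAddTorus (LatticeIndex Λ) :=
  fun i => ((latticeBasis Λ).repr x i : UnitAddCircle)

theorem isQuotientMap_toUnitTorus : Topology.IsQuotientMap (toUnitTorus Λ) := by
  have h1 : IsOpenQuotientMap (Pi.map fun (_ : LatticeIndex Λ) (t : ℝ) => (t : UnitAddCircle)) :=
    IsOpenQuotientMap.piMap fun _ => QuotientAddGroup.isOpenQuotientMap_mk
  have h2 : Topology.IsQuotientMap (latticeBasis Λ).equivFunL :=
    (latticeBasis Λ).equivFunL.toHomeomorph.isQuotientMap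
  exact h1.isQuotientMap.comp h2

theorem toUnitTorus_eq_iff (x y : Euc n) : toUnitTorus Λ x = toUnitTorus Λ y ↔ y - x ∈ Λ := by
  rw [mem_lattice_iff, funext_iff]
  refine forall_congr' fun i => ?_
  rw [toUnitTorus, toUnitTorus, QuotientAddGroup.eq, AddSubgroup.mem_zmultiples_iff]
  refine exists_congr fun a => ?_
  simp [sub_eq_neg_add]

theorem mFourier_toUnitTorus (m : LatticeIndex Λ → ℤ) (x : Euc n) :
    UnitAddTorus.mFourier m (toUnitTorus Λ x) = wave Λ m x := by
  rw [wave, inner_freq]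
  simp only [UnitAddTorus.mFourier, ContinuousMap.coe_mk, toUnitTorus, fourier_coe_apply]
  rw [← Complex.exp_sum]
  congr 1
  push_cast
  rw [Finset.mul_sum]
  exact Finset.sum_congr rfl fun i _ => by ring

theorem exists_comp_toUnitTorus {f : Euc n → ℂ} (hf : Continuous f)
    (hper : ∀ x, ∀ v ∈ Λ, f (x + v) = f x) :
    ∃ g : C(UnitAddTorus (LatticeIndex Λ), ℂ), ∀ x, g (toUnitTorus Λ x) = f x := by
  have hfac : Function.FactorsThrough f (toUnitTorus Λ) := by
    intro x y h
    have := hper x _ ((toUnitTorus_eq_iff x y).1 h)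
    rw [add_sub_cancel] at this
    exact this.symm
  let q : C(Euc n, UnitAddTorus (LatticeIndex Λ)) :=
    ⟨toUnitTorus Λ, isQuotientMap_toUnitTorus.continuous⟩
  have hq : Topology.IsQuotientMap q := isQuotientMap_toUnitTorus
  refine ⟨hq.lift ⟨f, hf⟩ hfac, fun x => ?_⟩
  exact congrFun (congrArg DFunLike.coe (hq.lift_comp ⟨f, hf⟩ hfac)) x

/-- `f` is orthogonal to all trigonometric polynomials, and these are uniformly dense on the
standard torus. Replacing the second factor by `g - P` with `‖g - P‖ < ε` bounds the integral by a
multiple of `ε`. The standard torus enters only topologically, so no measure has to be transported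
to it. -/
theorem integral_mul_conj_eq_zero {f : Euc n → ℂ} (hf : Continuous f)
    (hper : ∀ x, ∀ v ∈ Λ, f (x + v) = f x) (h0 : ∀ m, fourierCoef Λ m f = 0) :
    ∫ x in fundDomain Λ, f x * (starRingEnd ℂ) (f x) = 0 := by
  obtain ⟨g, hg⟩ := exists_comp_toUnitTorus hf hper
  have hqc : Continuous (toUnitTorus Λ) := isQuotientMap_toUnitTorus.continuous
  have hint : ∀ P : C(UnitAddTorus (LatticeIndex Λ), ℂ),
      IntegrableOn (fun x => f x * (starRingEnd ℂ) (P (toUnitTorus Λ x))) (fundDomain Λ) := fun P =>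
    integrableOn_fundDomain (hf.mul (Complex.continuous_conj.comp (P.continuous.comp hqc)))
  have hspan : ∀ P ∈ Submodule.span ℂ (Set.range (UnitAddTorus.mFourier (d := LatticeIndex Λ))),
      ∫ x in fundDomain Λ, f x * (starRingEnd ℂ) (P (toUnitTorus Λ x)) = 0 := by
    intro P hP
    induction hP using Submodule.span_induction with
    | mem P hP =>
      obtain ⟨m, rfl⟩ := hP
      simp only [mFourier_toUnitTorus]
      exact h0 m
    | zero => simp
    | add P Q _ _ hP hQ =>
      simp only [ContinuousMap.add_apply, map_add, mul_add]
      rw [integral_add (hint P) (hint Q), hP, hQ, add_zero]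
    | smul c P _ hP =>
      simp only [ContinuousMap.smul_apply, smul_eq_mul, map_mul, mul_left_comm (f _)]
      rw [integral_const_mul, hP, mul_zero]
  have hfin : volume (fundDomain Λ) < ⊤ := (ZSpan.fundamentalDomain_isBounded _).measure_lt_top
  have hbound : ∀ ε > 0, ‖∫ x in fundDomain Λ, f x * (starRingEnd ℂ) (f x)‖ ≤
      ε * (‖g‖ * volume.real (fundDomain Λ)) := by
    intro ε hε
    have hmem : g ∈ closure (Submodule.span ℂ
        (Set.range (UnitAddTorus.mFourier (d := LatticeIndex Λ))) : Set _) := by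
      rw [← Submodule.topologicalClosure_coe, UnitAddTorus.span_mFourier_closure_eq_top]
      trivial
    obtain ⟨P, hP, hgP⟩ := Metric.mem_closure_iff.1 hmem ε hε
    have h1 : ∫ x in fundDomain Λ, f x * (starRingEnd ℂ) (f x) =
        ∫ x in fundDomain Λ, f x * (starRingEnd ℂ) ((g - P) (toUnitTorus Λ x)) := by
      simp only [ContinuousMap.sub_apply, map_sub, mul_sub]
      rw [integral_sub (hint g) (hint P), hspan P hP, sub_zero]
      simp only [hg]
    rw [h1]
    refine (norm_setIntegral_le_of_norm_le_const (C := ‖g‖ * ε) hfin fun x _ => ?_).trans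
      (le_of_eq (by ring))
    rw [norm_mul, RCLike.norm_conj, ← hg x]
    gcongr
    · exact g.norm_coe_le_norm _
    · refine ((g - P).norm_coe_le_norm _).trans ?_
      rw [← dist_eq_norm]
      exact hgP.le
  have hle : ‖∫ x in fundDomain Λ, f x * (starRingEnd ℂ) (f x)‖ ≤ 0 := by
    refine le_of_forall_pos_le_add fun ε hε => ?_
    have hC : 0 ≤ ‖g‖ * volume.real (fundDomain Λ) := by positivity
    refine (hbound (ε / (‖g‖ * volume.real (fundDomain Λ) + 1)) (by positivity)).trans ?_
    rw [zero_add, div_mul_eq_mul_div, div_le_iff₀ (by positivity)]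
    nlinarith
  exact norm_le_zero_iff.1 hle

open scoped Pointwise in
/-- A continuous periodic function with vanishing Fourier coefficients vanishes. -/
theorem eq_zero_of_fourierCoef_eq_zero {f : Euc n → ℂ} (hf : Continuous f)
    (hper : ∀ x, ∀ v ∈ Λ, f (x + v) = f x) (h0 : ∀ m, fourierCoef Λ m f = 0) : f = 0 := by
  have h1 := integral_mul_conj_eq_zero hf hper h0
  have hc : Continuous fun x => Complex.normSq (f x) := Complex.continuous_normSq.comp hf
  simp only [Complex.mul_conj] at h1
  rw [integral_complex_ofReal, Complex.ofReal_eq_zero, integral_eq_zero_iff_of_nonneg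
    (fun x => Complex.normSq_nonneg _)
    ((integrableOn_fundDomain (Λ := Λ) (Complex.continuous_ofReal.comp hc)).re)] at h1
  have hD : IsAddFundamentalDomain Λ (fundDomain Λ) (volume : Measure (Euc n)) :=
    ZLattice.isAddFundamentalDomain (Module.Free.chooseBasis ℤ Λ) volume
  have hinv : VAddInvariantMeasure Λ (Euc n) volume :=
    inferInstanceAs <| VAddInvariantMeasure Λ.toAddSubgroup (Euc n) volume
  have hmeas : MeasurableSet (fundDomain Λ) := ZSpan.fundamentalDomain_measurableSet _
  -- The set where `f` does not vanish is invariant under `Λ` and null in a fundamental domain,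
  -- hence null.
  have h2 : volume {x | f x ≠ 0} = 0 := by
    refine hD.measure_zero_of_invariant _ (fun v => ?_) ?_
    · ext x
      rw [Set.mem_vadd_set_iff_neg_vadd_mem]
      have : f (-v +ᵥ x) = f x := by
        rw [Submodule.vadd_def, vadd_eq_add, add_comm]
        exact hper x _ (Submodule.coe_mem _)
      simp only [Set.mem_ofPred_eq, this]
    · rw [Filter.EventuallyEq, ae_restrict_iff' hmeas, ae_iff] at h1
      convert h1 using 2
      ext x
      simp [and_comm]
  have h3 : f =ᵐ[volume] 0 := by
    rw [Filter.EventuallyEq, ae_iff]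
    exact h2
  exact Continuous.ae_eq_iff_eq volume hf continuous_const |>.1 h3

end Fourier

end FlatTorus

end

noncomputable section

namespace FlatTorus

/-! ### Fourier coefficients of forms and multiplicities of eigenvalues -/

section FormCoefficients

variable {n : ℕ} {Λ : Submodule ℤ (Euc n)} [DiscreteTopology Λ] [IsZLattice ℝ Λ]

open MeasureTheory

theorem fourierCoef_coeff_fderiv {p : ℕ} (m : LatticeIndex Λ → ℤ) (ω : SmoothForm Λ p)
    (w : Fin p → Euc n) (v : Euc n) :
    fourierCoef Λ m (fun x => fderiv ℝ (pull ω) x v w) =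
      2 * Real.pi * Complex.I * (inner ℝ (freq Λ m) v : ℝ) *
        fourierCoef Λ m (fun x => pull ω x w) := by
  rw [← fourierCoef_fderiv m (contDiff_coeff ω w) (fun x u hu => by rw [pull_add_lattice ω x hu])]
  simp only [fderiv_coeff]

omit [DiscreteTopology Λ] [IsZLattice ℝ Λ] in
theorem continuous_fderiv_coeff {p : ℕ} (ω : SmoothForm Λ p) (w : Fin p → Euc n) (v : Euc n) :
    Continuous fun x => fderiv ℝ (pull ω) x v w := by
  simp only [← fderiv_coeff]
  exact ((contDiff_coeff ω w).continuous_fderiv (by simp)).clm_apply continuous_const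

theorem integrableOn_conj_wave_smul {p : ℕ} (m : LatticeIndex Λ → ℤ) (ω : SmoothForm Λ p) :
    IntegrableOn (fun x => (starRingEnd ℂ) (wave Λ m x) • pull ω x) (fundDomain Λ) := by
  have hc : Continuous fun x => (starRingEnd ℂ) (wave Λ m x) • pull ω x :=
    (Complex.continuous_conj.comp (continuous_wave m)).smul (contDiff_pull ω).continuous
  exact (hc.continuousOn.integrableOn_compact (ZSpan.fundamentalDomain_isBounded
    ((Module.Free.chooseBasis ℤ Λ).ofZLatticeBasis ℝ Λ)).isCompact_closure).mono_set
    subset_closure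

theorem integral_conj_wave_smul_apply {p : ℕ} (m : LatticeIndex Λ → ℤ) (ω : SmoothForm Λ p)
    (v : Fin p → Euc n) :
    (∫ x in fundDomain Λ, (starRingEnd ℂ) (wave Λ m x) • pull ω x) v =
      fourierCoef Λ m (fun x => pull ω x v) := by
  have h := (ContinuousAlternatingMap.apply ℝ (Euc n) ℂ v).integral_comp_comm
    (integrableOn_conj_wave_smul m ω)
  refine h.symm.trans ?_
  simp [fourierCoef, mul_comm]

/-- The (unnormalised) Fourier coefficient of a form. -/
def formCoef (p : ℕ) (m : LatticeIndex Λ → ℤ) : SmoothForm Λ p →ₗ[ℂ] AltForm n p where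
  toFun ω := ∫ x in fundDomain Λ, (starRingEnd ℂ) (wave Λ m x) • pull ω x
  map_add' ω η := by
    rw [← integral_add (integrableOn_conj_wave_smul m ω) (integrableOn_conj_wave_smul m η)]
    congr 1
    funext x
    exact smul_add _ (pull ω x) (pull η x)
  map_smul' c ω := by
    ext v
    rw [RingHom.id_apply, ContinuousAlternatingMap.smul_apply, integral_conj_wave_smul_apply,
      integral_conj_wave_smul_apply]
    have h := fourierCoef_sum {()} m (fun _ => c) (f := fun _ x => pull ω x v)
      (fun _ => (contDiff_coeff ω v).continuous)
    simp only [Finset.sum_singleton] at h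
    exact h

theorem formCoef_apply {p : ℕ} (m : LatticeIndex Λ → ℤ) (ω : SmoothForm Λ p)
    (v : Fin p → Euc n) : formCoef p m ω v = fourierCoef Λ m (fun x => pull ω x v) :=
  integral_conj_wave_smul_apply m ω v

theorem eq_zero_of_formCoef_eq_zero {p : ℕ} {ω : SmoothForm Λ p} (h : ∀ m, formCoef p m ω = 0) :
    ω = 0 := by
  apply pull_injective
  funext x
  ext v
  refine congrFun (eq_zero_of_fourierCoef_eq_zero (Λ := Λ) (f := fun x => pull ω x v)
    (contDiff_coeff ω v).continuous (fun x u hu => by rw [pull_add_lattice ω x hu]) fun m => ?_) x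
  rw [← formCoef_apply, h]
  rfl

theorem formCoef_d {p : ℕ} (m : LatticeIndex Λ → ℤ) (ω : SmoothForm Λ p) :
    formCoef (p + 1) m (d p ω) =
      (2 * Real.pi * Complex.I : ℂ) • wedge p (freq Λ m) (formCoef p m ω) := by
  ext v
  rw [formCoef_apply, ContinuousAlternatingMap.smul_apply, wedge_apply]
  have h := fourierCoef_sum Finset.univ m (fun i : Fin (p + 1) => (-1 : ℂ) ^ (i : ℕ))
    (f := fun i x => fderiv ℝ (pull ω) x (v i) (i.removeNth v))
    (fun i => continuous_fderiv_coeff ω _ _)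
  simp only [fourierCoef_coeff_fderiv] at h
  simp only [formCoef_apply, pull_d, extDeriv,
    ContinuousAlternatingMap.alternatizeUncurryFin_apply, smul_eq_mul, Finset.mul_sum]
  simp only [zsmul_eq_mul, Int.cast_pow, Int.cast_neg, Int.cast_one, Complex.real_smul]
  rw [h]
  exact Finset.sum_congr rfl fun i _ => by ring

theorem sum_inner_smul_stdVec (k : Euc n) : ∑ i, inner ℝ k (stdVec i) • (stdVec i : Euc n) = k := by
  ext j
  simp [EuclideanSpace.inner_single_right, Pi.single_apply]

/-- This collapses the sum over coordinate directions in the co-derivative to a single contraction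
with the frequency. -/
theorem sum_inner_mul_vecCons {p : ℕ} (k : Euc n) (a : AltForm n (p + 1)) (v : Fin p → Euc n) :
    ∑ i : Fin n, (inner ℝ k (stdVec i) : ℂ) * a (Matrix.vecCons (stdVec i) v) =
      contract p k a v := by
  have h : contract p k a = interior p a k := rfl
  rw [h]
  conv_rhs => rw [← sum_inner_smul_stdVec k, map_sum]
  simp [interior_apply]

theorem formCoef_codiff {p : ℕ} (m : LatticeIndex Λ → ℤ) (η : SmoothForm Λ (p + 1)) :
    formCoef p m (codiff p η) =
      (-(2 * Real.pi * Complex.I) : ℂ) • contract p (freq Λ m) (formCoef (p + 1) m η) := by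
  ext v
  rw [formCoef_apply, ContinuousAlternatingMap.smul_apply, ← sum_inner_mul_vecCons]
  have h := fourierCoef_sum Finset.univ m (fun _ : Fin n => (-1 : ℂ))
    (f := fun i x => fderiv ℝ (pull η) x (stdVec i) (Matrix.vecCons (stdVec i) v))
    (fun i => continuous_fderiv_coeff η _ _)
  simp only [fourierCoef_coeff_fderiv] at h
  have h2 : (fun x => pull (codiff p η) x v) = fun x => ∑ i : Fin n, (-1 : ℂ) *
      fderiv ℝ (pull η) x (stdVec i) (Matrix.vecCons (stdVec i) v) := by
    funext x
    simp [pull_codiff, euclCodiff, interior_apply]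
  rw [h2, h, smul_eq_mul, Finset.mul_sum]
  exact Finset.sum_congr rfl fun i _ => by rw [formCoef_apply]; ring

theorem four_pi_sq : (2 * Real.pi * Complex.I : ℂ) * -(2 * Real.pi * Complex.I) =
    ((4 * Real.pi ^ 2 : ℝ) : ℂ) := by
  push_cast
  linear_combination (-4 * (Real.pi : ℂ) ^ 2) * Complex.I_mul_I

theorem formCoef_F {p : ℕ} (α β : ℝ) (m : LatticeIndex Λ → ℤ) (ω : SmoothForm Λ (p + 1)) :
    formCoef (p + 1) m (F Λ α β (p + 1) ω) =
      ((4 * Real.pi ^ 2 : ℝ) : ℂ) • symbol α β p (freq Λ m) (formCoef (p + 1) m ω) := by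
  change formCoef (p + 1) m ((α : ℂ) • d p (codiff p ω) + (β : ℂ) • codiff (p + 1) (d (p + 1) ω)) =
    _
  rw [map_add, map_smul, map_smul, formCoef_d, formCoef_codiff, formCoef_codiff, formCoef_d,
    map_smul, map_smul, symbol_apply, ← four_pi_sq]
  ext v
  simp only [ContinuousAlternatingMap.add_apply, ContinuousAlternatingMap.smul_apply, smul_eq_mul]
  ring

/-- The form `exp(2πi⟨k, x⟩) a` with constant `a`. -/
def waveForm (p : ℕ) (m : LatticeIndex Λ → ℤ) : AltForm n p →ₗ[ℂ] SmoothForm Λ p where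
  toFun a := descend (fun x => wave Λ m x • a) ((contDiff_wave Λ m).smul contDiff_const)
    (fun x v hv => by rw [wave_add_lattice Λ m x hv])
  map_add' a b := by
    apply pull_injective
    funext x
    exact smul_add (wave Λ m x) a b
  map_smul' c a := by
    apply pull_injective
    funext x
    exact smul_comm (wave Λ m x) c a

theorem formCoef_waveForm_self {p : ℕ} (m : LatticeIndex Λ → ℤ) (a : AltForm n p) :
    formCoef p m (waveForm p m a) = (volume.real (fundDomain Λ) : ℂ) • a := by
  ext v
  have h := fourierCoef_sum {()} m (fun _ => a v) (f := fun _ => wave Λ m)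
    (fun _ => continuous_wave m)
  simp only [Finset.sum_singleton, fourierCoef_wave_self] at h
  rw [formCoef_apply, ContinuousAlternatingMap.smul_apply, smul_eq_mul, mul_comm, ← h]
  congr 1
  funext x
  exact mul_comm _ _

theorem formCoef_waveForm_of_ne {p : ℕ} {m m' : LatticeIndex Λ → ℤ} (hm : m ≠ m')
    (a : AltForm n p) : formCoef p m (waveForm p m' a) = 0 := by
  ext v
  have h := fourierCoef_sum {()} m (fun _ => a v) (f := fun _ => wave Λ m')
    (fun _ => continuous_wave m')
  simp only [Finset.sum_singleton, fourierCoef_wave_of_ne hm, mul_zero] at h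
  rw [formCoef_apply]
  refine Eq.trans ?_ h
  congr 1
  funext x
  exact mul_comm _ _

theorem ext_formCoef {p : ℕ} {ω η : SmoothForm Λ p} (h : ∀ m, formCoef p m ω = formCoef p m η) :
    ω = η :=
  sub_eq_zero.1 (eq_zero_of_formCoef_eq_zero fun m => by rw [map_sub, h, sub_self])

/-- A form is an eigenform if and only if its Fourier coefficients are eigenvectors of the
symbol. -/
theorem mem_Eig_iff {p : ℕ} (α β : ℝ) (ν : ℂ) (ω : SmoothForm Λ (p + 1)) :
    ω ∈ Eig Λ α β (p + 1) (((4 * Real.pi ^ 2 : ℝ) : ℂ) * ν) ↔ ∀ m,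
      formCoef (p + 1) m ω ∈ Module.End.eigenspace (symbol α β p (freq Λ m)) ν := by
  have h0 : ((4 * Real.pi ^ 2 : ℝ) : ℂ) ≠ 0 := by
    rw [Complex.ofReal_ne_zero]
    positivity
  have key : ∀ m, formCoef (p + 1) m (F Λ α β (p + 1) ω) =
      formCoef (p + 1) m ((((4 * Real.pi ^ 2 : ℝ) : ℂ) * ν) • ω) ↔
      formCoef (p + 1) m ω ∈ Module.End.eigenspace (symbol α β p (freq Λ m)) ν := by
    intro m
    rw [formCoef_F, map_smul, mul_smul, Module.End.mem_eigenspace_iff]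
    exact (smul_right_injective (AltForm n (p + 1)) h0).eq_iff
  rw [Eig, Module.End.mem_eigenspace_iff]
  exact ⟨fun h m => (key m).1 (by rw [h]), fun h => ext_formCoef fun m => (key m).2 (h m)⟩

/-- Taking the coefficients in `S` identifies the eigenspace with the product of the symbol
eigenspaces: it is injective since the remaining coefficients vanish, and surjective since finite
sums of wave forms are smooth. -/
theorem Spec_eq_sum {p : ℕ} (α β : ℝ) (ν : ℂ) (S : Finset (LatticeIndex Λ → ℤ))
    (hS : ∀ m ∉ S, Module.End.eigenspace (symbol α β p (freq Λ m)) ν = ⊥) :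
    Spec Λ α β (p + 1) (((4 * Real.pi ^ 2 : ℝ) : ℂ) * ν) =
      ((∑ m ∈ S, Module.finrank ℂ (Module.End.eigenspace (symbol α β p (freq Λ m)) ν) : ℕ) :
        Cardinal) := by
  let T : Eig Λ α β (p + 1) (((4 * Real.pi ^ 2 : ℝ) : ℂ) * ν) →ₗ[ℂ]
      ∀ m : S, Module.End.eigenspace (symbol α β p (freq Λ m.1)) ν :=
    LinearMap.pi fun m => ((formCoef (p + 1) m.1) ∘ₗ Submodule.subtype _).codRestrict _
      fun ω => (mem_Eig_iff α β ν ω.1).1 ω.2 m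
  have hT : ∀ ω m, ((T ω m : _) : AltForm n (p + 1)) = formCoef (p + 1) m.1 ω.1 := fun _ _ => rfl
  have hvol : (volume.real (fundDomain Λ) : ℂ) ≠ 0 := by
    exact_mod_cast volume_fundDomain_ne_zero
  have hinj : Function.Injective T := by
    intro ω η h
    refine Subtype.ext (ext_formCoef fun m => ?_)
    by_cases hm : m ∈ S
    · rw [← hT ω ⟨m, hm⟩, h, hT]
    · have h1 := (mem_Eig_iff α β ν ω.1).1 ω.2 m
      have h2 := (mem_Eig_iff α β ν η.1).1 η.2 m
      rw [hS m hm, Submodule.mem_bot] at h1 h2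
      rw [h1, h2]
  have hsurj : Function.Surjective T := by
    intro a
    -- Dividing by the volume compensates for the unnormalised Fourier coefficients.
    let ω : SmoothForm Λ (p + 1) := ∑ m : S, waveForm (p + 1) m.1
      ((volume.real (fundDomain Λ) : ℂ)⁻¹ • (a m : AltForm n (p + 1)))
    have h1 : ∀ m : S, formCoef (p + 1) m.1 ω = a m := by
      intro m
      rw [map_sum, Finset.sum_eq_single m, formCoef_waveForm_self, smul_inv_smul₀ hvol]
      · intro m' _ hm'
        exact formCoef_waveForm_of_ne (fun h => hm' (Subtype.ext h.symm)) _
      · simp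
    have h2 : ∀ m ∉ S, formCoef (p + 1) m ω = 0 := by
      intro m hm
      rw [map_sum]
      exact Finset.sum_eq_zero fun m' _ =>
        formCoef_waveForm_of_ne (fun h => hm (by rw [h]; exact m'.2)) _
    refine ⟨⟨ω, (mem_Eig_iff α β ν ω).2 fun m => ?_⟩, ?_⟩
    · by_cases hm : m ∈ S
      · rw [h1 ⟨m, hm⟩]
        exact Subtype.property _
      · rw [h2 m hm]
        exact Submodule.zero_mem _
    · funext m
      exact Subtype.ext (h1 m)
  rw [Spec, (LinearEquiv.ofBijective T ⟨hinj, hsurj⟩).rank_eq, ← Module.finrank_eq_rank,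
    Module.finrank_pi_fintype]
  exact congrArg _ (Finset.sum_coe_sort S fun m =>
    Module.finrank ℂ (Module.End.eigenspace (symbol α β p (freq Λ m)) ν))

/-! ### Counting dual lattice vectors by norm -/

/-- Only finitely many vectors of the dual lattice lie in a given ball. -/
theorem finite_norm_freq_le (r : ℝ) : {m : LatticeIndex Λ → ℤ | ‖freq Λ m‖ ^ 2 ≤ r}.Finite := by
  refine (Set.finite_Icc (fun i => -⌈(r + 1) * ‖latticeBasis Λ i‖⌉)
    (fun i => ⌈(r + 1) * ‖latticeBasis Λ i‖⌉)).subset fun m hm => ?_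
  have h : ∀ i, |m i| ≤ ⌈(r + 1) * ‖latticeBasis Λ i‖⌉ := by
    intro i
    have h1 := abs_real_inner_le_norm (freq Λ m) (latticeBasis Λ i)
    rw [inner_freq_basis] at h1
    -- The bound `2‖k‖ ≤ ‖k‖² + 1` avoids square roots.
    have h2 : ‖freq Λ m‖ ≤ r + 1 := by
      have : ‖freq Λ m‖ ^ 2 ≤ r := hm
      nlinarith [sq_nonneg (‖freq Λ m‖ - 1), norm_nonneg (freq Λ m)]
    have h3 : (|m i| : ℝ) ≤ (⌈(r + 1) * ‖latticeBasis Λ i‖⌉ : ℤ) :=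
      h1.trans ((mul_le_mul_of_nonneg_right h2 (norm_nonneg _)).trans (Int.le_ceil _))
    exact_mod_cast h3
  exact ⟨fun i => (abs_le.1 (h i)).1, fun i => (abs_le.1 (h i)).2⟩

variable (Λ) in
/-- The number of vectors of the dual lattice with a given squared norm. -/
def freqCount (r : ℝ) : ℕ := {m : LatticeIndex Λ → ℤ | ‖freq Λ m‖ ^ 2 = r}.ncard

theorem finite_norm_freq_eq (r : ℝ) : {m : LatticeIndex Λ → ℤ | ‖freq Λ m‖ ^ 2 = r}.Finite :=
  (finite_norm_freq_le r).subset fun _ hm => le_of_eq hm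

theorem freqCount_pos_iff (r : ℝ) :
    0 < freqCount Λ r ↔ ∃ m : LatticeIndex Λ → ℤ, ‖freq Λ m‖ ^ 2 = r :=
  Set.ncard_pos (finite_norm_freq_eq r)

/-- A common finite set of frequencies that carries the eigenforms for a given eigenvalue. -/
theorem exists_finset_Spec_eq (hn : n ≠ 0) {p : ℕ} {α β : ℝ} (hα : 0 < α) (hβ : 0 < β)
    (ν : ℂ) : ∃ R : ℝ, ∀ R' ≥ R,
    Spec Λ α β (p + 1) (((4 * Real.pi ^ 2 : ℝ) : ℂ) * ν) =
      ((∑ m ∈ (finite_norm_freq_le (Λ := Λ) R').toFinset,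
        Module.finrank ℂ (Module.End.eigenspace (symbol α β p (freq Λ m)) ν) : ℕ) :
          Cardinal) := by
  -- Beyond this radius `α‖k‖²` and `β‖k‖²` both exceed `‖ν‖`, so neither equals `ν`. Allowing any
  -- larger `R'` lets two operators be compared over the same ball.
  refine ⟨max (‖ν‖ / α) (‖ν‖ / β), fun R' hR => Spec_eq_sum α β ν _ fun m hm => ?_⟩
  rw [Set.Finite.mem_toFinset, Set.mem_ofPred_eq, not_le] at hm
  have hα' := (le_max_left _ _).trans_lt (lt_of_le_of_lt hR hm)
  have hβ' := (le_max_right _ _).trans_lt (lt_of_le_of_lt hR hm)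
  rw [div_lt_iff₀ hα] at hα'
  rw [div_lt_iff₀ hβ] at hβ'
  rw [← Submodule.finrank_eq_zero (R := ℂ), finrank_eigenspace_symbol hn, if_neg, if_neg]
  · rintro rfl
    rw [Complex.norm_real, Real.norm_of_nonneg (by positivity), mul_comm] at hβ'
    exact lt_irrefl _ hβ'
  · rintro rfl
    rw [Complex.norm_real, Real.norm_of_nonneg (by positivity), mul_comm] at hα'
    exact lt_irrefl _ hα'

theorem isospectral_of_finrank_eq (hn : n ≠ 0) {p : ℕ} {α β α' β' : ℝ} (hα : 0 < α) (hβ : 0 < β)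
    (hα' : 0 < α') (hβ' : 0 < β')
    (h : ∀ (k : Euc n) (ν : ℂ),
      Module.finrank ℂ (Module.End.eigenspace (symbol α β p k) ν) =
        Module.finrank ℂ (Module.End.eigenspace (symbol α' β' p k) ν)) :
    Isospectral Λ (p + 1) α β α' β' := by
  have h0 : ((4 * Real.pi ^ 2 : ℝ) : ℂ) ≠ 0 := by
    rw [Complex.ofReal_ne_zero]
    positivity
  funext μ
  obtain ⟨ν, rfl⟩ : ∃ ν, μ = ((4 * Real.pi ^ 2 : ℝ) : ℂ) * ν :=
    ⟨((4 * Real.pi ^ 2 : ℝ) : ℂ)⁻¹ * μ, (mul_inv_cancel_left₀ h0 μ).symm⟩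
  obtain ⟨R, hR⟩ := exists_finset_Spec_eq (Λ := Λ) (p := p) hn hα hβ ν
  obtain ⟨R', hR'⟩ := exists_finset_Spec_eq (Λ := Λ) (p := p) hn hα' hβ' ν
  rw [hR _ (le_max_left R R'), hR' _ (le_max_right R R')]
  simp only [h]

theorem Spec_eq_freqCount (hn : n ≠ 0) {p : ℕ} {α β : ℝ} (hα : 0 < α) (hβ : 0 < β) (ν : ℝ) :
    Spec Λ α β (p + 1) (((4 * Real.pi ^ 2 : ℝ) : ℂ) * (ν : ℂ)) =
      (((n - 1).choose p * freqCount Λ (ν / α) + (n - 1).choose (p + 1) * freqCount Λ (ν / β) : ℕ) :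
        Cardinal) := by
  classical
  obtain ⟨R, hR⟩ := exists_finset_Spec_eq (Λ := Λ) (p := p) hn hα hβ ν
  have hcount : ∀ (c : ℝ), 0 < c → ∀ (A : ℕ) (R' : ℝ), ν / c ≤ R' →
      ∑ m ∈ (finite_norm_freq_le (Λ := Λ) R').toFinset,
        (if (ν : ℂ) = ((c * ‖freq Λ m‖ ^ 2 : ℝ) : ℂ) then A else 0) = A * freqCount Λ (ν / c) := by
    intro c hc A R' hR'
    rw [← Finset.sum_filter, Finset.sum_const, smul_eq_mul, mul_comm, freqCount,
      Set.ncard_eq_toFinset_card _ (finite_norm_freq_eq _)]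
    congr 2
    ext m
    simp only [Finset.mem_filter, Set.Finite.mem_toFinset, Set.mem_ofPred_eq, Complex.ofReal_inj]
    rw [eq_div_iff hc.ne', eq_comm (a := ν), mul_comm c, and_iff_right_iff_imp]
    intro h
    rw [← h, mul_div_assoc, div_self hc.ne', mul_one] at hR'
    exact hR'
  rw [hR (max R (max (ν / α) (ν / β))) (le_max_left _ _)]
  simp only [finrank_eigenspace_symbol hn, Finset.sum_add_distrib]
  rw [hcount α hα _ _ ((le_max_left _ _).trans (le_max_right _ _)),
    hcount β hβ _ _ ((le_max_right _ _).trans (le_max_right _ _))]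

/-- `s` is the squared length of a shortest nonzero dual lattice vector. The vector `m₁` in the
proof is merely some nonzero competitor, which makes the search finite. -/
theorem exists_min_freqCount (hn : n ≠ 0) :
    ∃ s > 0, 0 < freqCount Λ s ∧ ∀ r, 0 < r → r < s → freqCount Λ r = 0 := by
  have hpos : ∀ m : LatticeIndex Λ → ℤ, m ≠ 0 → 0 < ‖freq Λ m‖ ^ 2 := by
    intro m hm
    obtain ⟨i, hi⟩ := Function.ne_iff.1 hm
    have : freq Λ m ≠ 0 := by
      intro h
      have h1 := inner_freq_basis Λ m i
      rw [h, inner_zero_left] at h1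
      exact hi (by exact_mod_cast h1.symm)
    positivity
  have hne : Nonempty (LatticeIndex Λ) := by
    by_contra h
    rw [not_nonempty_iff] at h
    have h1 := Module.finrank_eq_card_basis (latticeBasis Λ)
    rw [finrank_euclideanSpace_fin, Fintype.card_eq_zero] at h1
    exact hn h1
  let m₁ : LatticeIndex Λ → ℤ := fun _ => 1
  have hm₁ : m₁ ≠ 0 := fun h => one_ne_zero (congrFun h hne.some)
  have hfin : {m : LatticeIndex Λ → ℤ | ‖freq Λ m‖ ^ 2 ≤ ‖freq Λ m₁‖ ^ 2 ∧ m ≠ 0}.Finite :=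
    (finite_norm_freq_le _).subset fun _ h => h.1
  obtain ⟨m₀, hm₀, hmin⟩ := Set.exists_min_image _ (fun m => ‖freq Λ m‖ ^ 2) hfin
    ⟨m₁, le_refl _, hm₁⟩
  refine ⟨_, hpos m₀ hm₀.2, (freqCount_pos_iff _).2 ⟨m₀, rfl⟩, fun r hr hlt => ?_⟩
  by_contra h
  obtain ⟨m, rfl⟩ := (freqCount_pos_iff r).1 (Nat.pos_of_ne_zero h)
  have hm : m ≠ 0 := by
    rintro rfl
    have h1 : freq Λ 0 = 0 := by simp [freq]
    simp [h1] at hr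
  exact absurd (hmin m ⟨hlt.le.trans hm₀.1, hm⟩) (not_le.2 hlt)

end FormCoefficients

end FlatTorus

end

namespace FlatTorus

/-! ### Recovering the parameters from a weighted count `N` that vanishes on `(0, s)` -/

section Rigidity

variable {N : ℝ → ℕ} {s : ℝ} {α β α' β' : ℝ} {A B : ℕ}

theorem eq_zero_of_lt (hs : 0 < s) (hN : ∀ r, 0 < r → r < s → N r = 0) (hα : 0 < α)
    (h : α < β) : N (s * α / β) = 0 := by
  have hβ := hα.trans h
  refine hN _ (by positivity) ?_
  rw [div_lt_iff₀ hβ]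
  gcongr

/-- At `ν = s α` the left count is `N s > 0`; if `α < α'`, the right count would be taken inside the
gap `(0, s)`. -/
theorem le_of_count_eq (hs : 0 < s) (hNs : 0 < N s) (hN : ∀ r, 0 < r → r < s → N r = 0)
    (hα : 0 < α) (h : ∀ ν, N (ν / α) = N (ν / α')) : α' ≤ α := by
  by_contra! hlt
  have h1 := h (s * α)
  rw [eq_zero_of_lt hs hN hα hlt, mul_div_cancel_right₀ _ hα.ne'] at h1
  omega

theorem eq_of_count_eq (hs : 0 < s) (hNs : 0 < N s) (hN : ∀ r, 0 < r → r < s → N r = 0)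
    (hα : 0 < α) (hα' : 0 < α') (h : ∀ ν, N (ν / α) = N (ν / α')) : α = α' :=
  le_antisymm (le_of_count_eq hs hNs hN hα' fun ν => (h ν).symm)
    (le_of_count_eq hs hNs hN hα h)

theorem min_le_of_count_eq (hs : 0 < s) (hNs : 0 < N s) (hN : ∀ r, 0 < r → r < s → N r = 0)
    (hα : 0 < α) (hβ : 0 < β) (hA : 0 < A) (hB : 0 < B)
    (h : ∀ ν, A * N (ν / α) + B * N (ν / β) = A * N (ν / α') + B * N (ν / β')) :
    min α' β' ≤ min α β := by
  by_contra! hlt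
  have hlt1 := hlt.trans_le (min_le_left α' β')
  have hlt2 := hlt.trans_le (min_le_right α' β')
  have hpos : 0 < min α β := lt_min hα hβ
  have h1 := h (s * min α β)
  rw [eq_zero_of_lt hs hN hpos hlt1, eq_zero_of_lt hs hN hpos hlt2] at h1
  have hAN := Nat.mul_pos hA hNs
  have hBN := Nat.mul_pos hB hNs
  rcases min_choice α β with hm | hm
  · rw [hm, mul_div_cancel_right₀ _ hα.ne'] at h1
    omega
  · rw [hm, mul_div_cancel_right₀ _ hβ.ne'] at h1
    omega

theorem min_eq_of_count_eq (hs : 0 < s) (hNs : 0 < N s) (hN : ∀ r, 0 < r → r < s → N r = 0)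
    (hα : 0 < α) (hβ : 0 < β) (hα' : 0 < α') (hβ' : 0 < β') (hA : 0 < A) (hB : 0 < B)
    (h : ∀ ν, A * N (ν / α) + B * N (ν / β) = A * N (ν / α') + B * N (ν / β')) :
    min α β = min α' β' :=
  le_antisymm (min_le_of_count_eq hs hNs hN hα' hβ' hA hB fun ν => (h ν).symm)
    (min_le_of_count_eq hs hNs hN hα hβ hA hB h)

theorem right_eq_of_left_eq (hs : 0 < s) (hNs : 0 < N s) (hN : ∀ r, 0 < r → r < s → N r = 0)
    (hβ : 0 < β) (hβ' : 0 < β') (hB : 0 < B)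
    (h : ∀ ν, A * N (ν / α) + B * N (ν / β) = A * N (ν / α) + B * N (ν / β')) : β = β' :=
  eq_of_count_eq hs hNs hN hβ hβ' fun ν =>
    Nat.eq_of_mul_eq_mul_left hB (Nat.add_left_cancel (h ν))

/-- Only a parameter attaining the minimum contributes; the other one evaluates `N` inside the gap.
In a tie both contribute. -/
theorem count_at_min (hs : 0 < s) (hN : ∀ r, 0 < r → r < s → N r = 0)
    (hα : 0 < α) (hβ : 0 < β) :
    A * N (s * min α β / α) + B * N (s * min α β / β) =
      ((if α ≤ β then A else 0) + (if β ≤ α then B else 0)) * N s := by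
  rcases lt_trichotomy α β with h | h | h
  · rw [min_eq_left h.le, eq_zero_of_lt hs hN hα h, mul_div_cancel_right₀ _ hα.ne',
      if_pos h.le, if_neg (not_le.2 h), mul_zero, add_zero, add_zero]
  · subst h
    rw [min_self, mul_div_cancel_right₀ _ hα.ne', if_pos le_rfl, if_pos le_rfl, add_mul]
  · rw [min_eq_right h.le, eq_zero_of_lt hs hN hβ h, mul_div_cancel_right₀ _ hβ.ne',
      if_pos h.le, if_neg (not_le.2 h), mul_zero, zero_add, zero_add]

theorem eq_and_eq_of_count_eq (hs : 0 < s) (hNs : 0 < N s)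
    (hN : ∀ r, 0 < r → r < s → N r = 0) (hα : 0 < α) (hβ : 0 < β) (hα' : 0 < α') (hβ' : 0 < β')
    (hA : 0 < A) (hB : 0 < B) (hAB : A ≠ B)
    (h : ∀ ν, A * N (ν / α) + B * N (ν / β) = A * N (ν / α') + B * N (ν / β')) :
    α = α' ∧ β = β' := by
  have hmin := min_eq_of_count_eq hs hNs hN hα hβ hα' hβ' hA hB h
  have h1 := h (s * min α β)
  rw [count_at_min hs hN hα hβ, hmin, count_at_min hs hN hα' hβ'] at h1
  have h2 := Nat.eq_of_mul_eq_mul_right hNs h1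
  have hor : α = α' ∨ β = β' := by
    rcases le_total α β with hle | hle <;> rcases le_total α' β' with hle' | hle'
    · left
      rwa [min_eq_left hle, min_eq_left hle'] at hmin
    -- The minima are attained in opposite slots. Since `A`, `B` and `A + B` are distinct, the
    -- multiplicities agree only if both pairs are ties.
    · rw [if_pos hle, if_pos hle'] at h2
      split_ifs at h2 with h3 h4 h4
      · left
        rwa [min_eq_left hle, min_eq_left h4] at hmin
      all_goals omega
    · rw [if_pos hle, if_pos hle'] at h2
      split_ifs at h2 with h3 h4 h4
      · left
        rwa [min_eq_left h3, min_eq_left hle'] at hmin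
      all_goals omega
    · right
      rwa [min_eq_right hle, min_eq_right hle'] at hmin
  rcases hor with rfl | rfl
  · exact ⟨rfl, right_eq_of_left_eq hs hNs hN hβ hβ' hB h⟩
  · refine ⟨right_eq_of_left_eq (A := B) (α := β) hs hNs hN hα hα' hA fun ν => ?_, rfl⟩
    rw [add_comm, h, add_comm]

/-- With equal weights the multiplicity cannot tell which parameter attains the minimum, so each
combination of slots is treated separately: the common summand cancels and the remaining parameters
agree. -/
theorem pair_eq_of_count_eq (hs : 0 < s) (hNs : 0 < N s)
    (hN : ∀ r, 0 < r → r < s → N r = 0) (hα : 0 < α) (hβ : 0 < β) (hα' : 0 < α') (hβ' : 0 < β')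
    (hA : 0 < A)
    (h : ∀ ν, A * N (ν / α) + A * N (ν / β) = A * N (ν / α') + A * N (ν / β')) :
    α = α' ∧ β = β' ∨ α = β' ∧ β = α' := by
  have hmin := min_eq_of_count_eq hs hNs hN hα hβ hα' hβ' hA hA h
  rcases min_choice α β with h1 | h1 <;> rcases min_choice α' β' with h2 | h2 <;>
    rw [h1, h2] at hmin <;> subst hmin
  · exact Or.inl ⟨rfl, right_eq_of_left_eq hs hNs hN hβ hβ' hA h⟩
  · refine Or.inr ⟨rfl, right_eq_of_left_eq (A := A) (α := α) hs hNs hN hβ hα' hA fun ν => ?_⟩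
    rw [h, add_comm]
  · refine Or.inr ⟨right_eq_of_left_eq (A := A) (α := β) hs hNs hN hα hβ' hA fun ν => ?_, rfl⟩
    rw [add_comm, h]
  · refine Or.inl ⟨right_eq_of_left_eq (A := A) (α := β) hs hNs hN hα hα' hA fun ν => ?_, rfl⟩
    rw [add_comm, h, add_comm]

end Rigidity

theorem count_eq_of_isospectral {n : ℕ} {Λ : Submodule ℤ (Euc n)} [DiscreteTopology Λ]
    [IsZLattice ℝ Λ] (hn : n ≠ 0) {p : ℕ} {α β α' β' : ℝ} (hα : 0 < α) (hβ : 0 < β)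
    (hα' : 0 < α') (hβ' : 0 < β') (h : Isospectral Λ (p + 1) α β α' β') (ν : ℝ) :
    (n - 1).choose p * freqCount Λ (ν / α) + (n - 1).choose (p + 1) * freqCount Λ (ν / β) =
      (n - 1).choose p * freqCount Λ (ν / α') + (n - 1).choose (p + 1) * freqCount Λ (ν / β') := by
  have h1 := congrFun h (((4 * Real.pi ^ 2 : ℝ) : ℂ) * (ν : ℂ))
  rw [Spec_eq_freqCount hn hα hβ, Spec_eq_freqCount hn hα' hβ'] at h1
  exact_mod_cast h1

end FlatTorus

/-! ### The three cases -/

theorem mainTheorem4 {n : ℕ} (Λ : Submodule ℤ (EuclideanSpace ℝ (Fin n)))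
    [DiscreteTopology Λ] [IsZLattice ℝ Λ] (p : ℕ) (hp : 1 ≤ p) (hpn : p ≤ n)
    (α β α' β' : ℝ) (hα : 0 < α) (hβ : 0 < β) (hα' : 0 < α') (hβ' : 0 < β') :
    (p < n → n ≠ 2 * p →
      (FlatTorus.Isospectral Λ p α β α' β' ↔ (α, β) = (α', β'))) ∧
    (n = 2 * p →
      (FlatTorus.Isospectral Λ p α β α' β' ↔ ({α, β} : Set ℝ) = {α', β'})) ∧
    (p = n → (FlatTorus.Isospectral Λ p α β α' β' ↔ α = α')) := by
  obtain ⟨q, rfl⟩ : ∃ q, p = q + 1 := ⟨p - 1, by omega⟩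
  have hn : n ≠ 0 := by omega
  obtain ⟨s, hs, hNs, hN⟩ := FlatTorus.exists_min_freqCount (Λ := Λ) hn
  have hA : 0 < (n - 1).choose q := Nat.choose_pos (by omega)
  have hcount := FlatTorus.count_eq_of_isospectral (Λ := Λ) (p := q) hn hα hβ hα' hβ'
  refine ⟨fun hlt hne => ⟨fun h => ?_, fun h => ?_⟩, fun heq => ⟨fun h => ?_, fun h => ?_⟩,
    fun heq => ⟨fun h => ?_, fun h => ?_⟩⟩
  · have hB : 0 < (n - 1).choose (q + 1) := Nat.choose_pos (by omega)
    have hAB : (n - 1).choose q ≠ (n - 1).choose (q + 1) := by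
      intro h1
      -- From `C(m, q+1)(q+1) = C(m, q)(m-q)` with `m = n - 1`, equal binomials force `q + 1 = n - 1
      -- - q`, that is, the excluded middle degree.
      have h2 := Nat.choose_succ_right_eq (n - 1) q
      rw [← h1] at h2
      have h3 := Nat.eq_of_mul_eq_mul_left hA h2
      omega
    rw [Prod.mk.injEq]
    exact FlatTorus.eq_and_eq_of_count_eq hs hNs hN hα hβ hα' hβ' hA hB hAB (hcount h)
  · rw [Prod.mk.injEq] at h
    rw [h.1, h.2]
    rfl
  · have hAB : (n - 1).choose (q + 1) = (n - 1).choose q := by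
      -- Here `n - 1 = 2q + 1`, so these are the two central binomial coefficients.
      rw [heq]
      exact Nat.choose_symm_half q
    simp only [hAB] at hcount
    rw [Set.pair_eq_pair_iff]
    exact FlatTorus.pair_eq_of_count_eq hs hNs hN hα hβ hα' hβ' hA (hcount h)
  · have hAB : (n - 1).choose (q + 1) = (n - 1).choose q := by
      rw [heq]
      exact Nat.choose_symm_half q
    refine FlatTorus.isospectral_of_finrank_eq hn hα hβ hα' hβ' fun k ν => ?_
    rw [FlatTorus.finrank_eigenspace_symbol hn, FlatTorus.finrank_eigenspace_symbol hn, hAB]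
    rcases Set.pair_eq_pair_iff.1 h with ⟨rfl, rfl⟩ | ⟨rfl, rfl⟩
    · rfl
    · exact add_comm _ _
  -- In top degree `n - 1 < q + 1`, so the `β` term has weight zero.
  · have hB : (n - 1).choose (q + 1) = 0 := Nat.choose_eq_zero_of_lt (by omega)
    refine FlatTorus.eq_of_count_eq hs hNs hN hα hα' fun ν => ?_
    have h1 := hcount h ν
    rw [hB, zero_mul, zero_mul, add_zero, add_zero] at h1
    exact Nat.eq_of_mul_eq_mul_left hA h1
  · have hB : (n - 1).choose (q + 1) = 0 := Nat.choose_eq_zero_of_lt (by omega)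
    refine FlatTorus.isospectral_of_finrank_eq hn hα hβ hα' hβ' fun k ν => ?_
    rw [FlatTorus.finrank_eigenspace_symbol hn, FlatTorus.finrank_eigenspace_symbol hn, hB, h]
    simp only [ite_self]
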